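/- Let $\gamma\in\mathbb{R}\setminus\{0,-4\}$ and consider $N=5$ point vortices in the plane with circulations $\Gamma_1=\Gamma_2=\Gamma_3=\Gamma_4=1$, $\Gamma_5=\gamma$, so that $\Gamma:=\sum_{i=1}^5\Gamma_i=\gamma+4\neq0$. Let $\mathfrak{v}\cong\mathbb{R}^{16}$ be the real vector space of skew-Hermitian matrices $\mu\in\mathbb{C}^{4\times4}$, with the inner product $\langle\xi,\eta\rangle=\tfrac12\operatorname{tr}(\xi^*\eta)$. Write $\mu=\mathrm{i}\,[\mu_{ij}]$ with $[\mu_{ij}]$ Hermitian and $\mu_i:=\mu_{ii}\in\mathbb{R}$. Let $\mathcal{K}$ be the real $4\times4$ matrix with entries $\mathcal{K}_{ii}=-\Gamma_i(\Gamma-\Gamma_i)/\Gamma$ and $\mathcal{K}_{ij}=\Gamma_i\Gamma_j/\Gamma$ for $i\ne j$, and let $$h(\mu)=-\frac1{4\pi}\Bigl(\Gamma_5\sum_{i=1}^{4}\Gamma_i\ln\mu_i+\sum_{1\le i<j\le4}\Gamma_i\Gamma_j\ln(\mu_i+\mu_j-2\operatorname{Re}\mu_{ij})\Bigr)$$ on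 the open set $D\subset\mathfrak{v}$ where all arguments of the logarithms are positive. The Lie–Poisson relative dynamics is the equation on $D$ $$\dot\mu=X_h(\mu):=-\mu\,\frac{\delta h}{\delta\mu}\,\mathcal{K}^{-1}+\mathcal{K}^{-1}\,\frac{\delta h}{\delta\mu}\,\mu ,$$ where $\delta h/\delta\mu\in\mathfrak{v}$ is defined by $\langle\nu,\delta h/\delta\mu\rangle=\frac{d}{ds}\big|_{s=0}h(\mu+s\nu)$ for all $\nu\in\mathfrak{v}$. Place the four unit vortices at the vertices of a square, in counterclockwise order and at distance $1$ from its centre, and the fifth vortex at the centre: $q=(1,\mathrm{i},-1,-\mathrm{i},0)\in\mathbb{C}^5$. Put $z=(q_i-q_5)_{i=1}^4$ and $\mu_0=\mathrm{i}\,zz^*$. Then $\mu_0$ is a fixed point, $X_h(\mu_0)=0$, and: * if $0<\gamma<9/4$, then $\mu_0$ is Lyapunov stable: for every $\varepsilon>0$ there is $\delta>0$ such that for every $\nu\in D$ with $\|\nu-\mu_0\|<\delta$ there is a solution in $D$ with $\mu(0)=\nu$ for all $t\ge0$, and every solution in $D$ with $\mu(0)=\nu$, on any interval $[0,T)$, satisfies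 $\|\mu(t)-\mu_0\|<\varepsilon$ there; * if $\gamma<-1/2$ or $\gamma>9/4$, then $\mu_0$ is linearly unstable: the linearization $DX_h(\mu_0)$ has a (complex) eigenvalue with positive real part. -/

import Mathlib

noncomputable section

open Matrix

namespace VortexRelative

/-! `N = n + 1` point vortices with circulations `Γ : Fin (n + 1) → ℝ`; the last vortex is the
reference vortex of the relative coordinates. -/

/-- The real vector space `𝔳` of skew-Hermitian `n × n` complex matrices, of dimension `n ^ 2`.
(A type synonym, so that it carries only the norm of the inner product defined below.) -/
def ShapeSpace (n : ℕ) : Type :=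
  skewAdjoint.submodule ℝ (Matrix (Fin n) (Fin n) ℂ)

namespace ShapeSpace

instance instAddCommGroup (n : ℕ) : AddCommGroup (ShapeSpace n) :=
  inferInstanceAs (AddCommGroup (skewAdjoint.submodule ℝ (Matrix (Fin n) (Fin n) ℂ)))

instance instModule (n : ℕ) : Module ℝ (ShapeSpace n) :=
  inferInstanceAs (Module ℝ (skewAdjoint.submodule ℝ (Matrix (Fin n) (Fin n) ℂ)))

instance instFiniteDimensional (n : ℕ) : FiniteDimensional ℝ (ShapeSpace n) :=
  inferInstanceAs
    (FiniteDimensional ℝ (skewAdjoint.submodule ℝ (Matrix (Fin n) (Fin n) ℂ)))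

/-- The inclusion of `𝔳` into the complex matrices. -/
def toMatrix {n : ℕ} : ShapeSpace n →ₗ[ℝ] Matrix (Fin n) (Fin n) ℂ :=
  (skewAdjoint.submodule ℝ (Matrix (Fin n) (Fin n) ℂ)).subtype

/-- The element of `𝔳` given by a skew-Hermitian matrix. -/
def ofMatrix {n : ℕ} (M : Matrix (Fin n) (Fin n) ℂ) (hM : Mᴴ = -M) : ShapeSpace n :=
  ⟨M, hM⟩

@[simp] theorem toMatrix_ofMatrix {n : ℕ} (M : Matrix (Fin n) (Fin n) ℂ) (hM : Mᴴ = -M) :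
    toMatrix (ofMatrix M hM) = M := rfl

theorem toMatrix_injective {n : ℕ} :
    Function.Injective (toMatrix : ShapeSpace n →ₗ[ℝ] Matrix (Fin n) (Fin n) ℂ) :=
  Subtype.val_injective

theorem conjTranspose_toMatrix {n : ℕ} (μ : ShapeSpace n) : (toMatrix μ)ᴴ = -toMatrix μ :=
  μ.2

open scoped ComplexOrder in
/-- The inner product `⟨ξ, η⟩ = (1/2) tr (ξ* η)` on `𝔳` (the trace is real there). -/
@[reducible] def innerCore (n : ℕ) : InnerProductSpace.Core ℝ (ShapeSpace n) where
  inner ξ η := (1 / 2) * ((toMatrix ξ)ᴴ * toMatrix η).trace.re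
  conj_inner_symm ξ η := by
    have h : ((toMatrix ξ)ᴴ * toMatrix η)ᴴ = (toMatrix η)ᴴ * toMatrix ξ := by simp
    have h2 := congrArg (fun M => (trace M).re) h
    simp only [trace_conjTranspose] at h2
    simp [← h2]
  re_inner_nonneg ξ := by
    have : 0 ≤ ((toMatrix ξ)ᴴ * toMatrix ξ).trace.re := by
      simp only [trace, diag_apply, mul_apply, conjTranspose_apply, Complex.re_sum]
      refine Finset.sum_nonneg fun i _ => Finset.sum_nonneg fun j _ => ?_
      simp only [Complex.star_def, Complex.mul_re, Complex.conj_re, Complex.conj_im]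
      nlinarith [mul_self_nonneg (toMatrix ξ j i).re, mul_self_nonneg (toMatrix ξ j i).im]
    simpa using this
  add_left ξ η ζ := by
    simp [add_mul]; ring
  smul_left ξ η r := by
    simp
    ring
  definite ξ h := by
    apply toMatrix_injective
    rw [map_zero, ← trace_conjTranspose_mul_self_eq_zero_iff]
    have him : ((toMatrix ξ)ᴴ * toMatrix ξ).trace.im = 0 := by
      have h := congrArg Complex.im (trace_conjTranspose ((toMatrix ξ)ᴴ * toMatrix ξ))
      simp at h
      linarith
    refine Complex.ext ?_ him
    simpa using h

instance instNormedAddCommGroup (n : ℕ) : NormedAddCommGroup (ShapeSpace n) :=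
  (innerCore n).toNormedAddCommGroup

instance instInnerProductSpace (n : ℕ) : InnerProductSpace ℝ (ShapeSpace n) :=
  InnerProductSpace.ofCore (innerCore n).toCore

instance instCompleteSpace (n : ℕ) : CompleteSpace (ShapeSpace n) :=
  FiniteDimensional.complete ℝ (ShapeSpace n)

theorem inner_def {n : ℕ} (ξ η : ShapeSpace n) :
    inner ℝ ξ η = (1 / 2) * ((toMatrix ξ)ᴴ * toMatrix η).trace.re := rfl

end ShapeSpace

open ShapeSpace

/-- The entry `μ_{ij}` of `μ = i [μ_{ij}]`, where `[μ_{ij}]` is Hermitian. -/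
def entry {n : ℕ} (μ : ShapeSpace n) (i j : Fin n) : ℂ :=
  -Complex.I * toMatrix μ i j

/-- The (real) diagonal entry `μ_i = μ_{ii}`; it is `|q_i - q_N|²` when `μ = i z z*`. -/
def sqDistRef {n : ℕ} (μ : ShapeSpace n) (i : Fin n) : ℝ :=
  (entry μ i i).re

/-- `μ_i + μ_j - 2 Re μ_{ij}`; it is `|q_i - q_j|²` when `μ = i z z*`. -/
def sqDist {n : ℕ} (μ : ShapeSpace n) (i j : Fin n) : ℝ :=
  sqDistRef μ i + sqDistRef μ j - 2 * (entry μ i j).re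

/-- The open set of `μ` at which the logarithms in the Hamiltonian are defined
(no collisions). -/
def collisionFree (n : ℕ) : Set (ShapeSpace n) :=
  {μ | (∀ i, 0 < sqDistRef μ i) ∧ ∀ i j, i < j → 0 < sqDist μ i j}

/-- Total circulation. -/
def totalCirculation {n : ℕ} (Γ : Fin (n + 1) → ℝ) : ℝ := ∑ i, Γ i

/-- The matrix `𝒦`. -/
def kMatrix {n : ℕ} (Γ : Fin (n + 1) → ℝ) : Matrix (Fin n) (Fin n) ℝ :=
  (1 / totalCirculation Γ) • Matrix.of fun i j =>
    if i = j then -(Γ i.castSucc * (totalCirculation Γ - Γ i.castSucc))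
    else Γ i.castSucc * Γ j.castSucc

/-- `𝒦⁻¹`, as a complex matrix. -/
def kInv {n : ℕ} (Γ : Fin (n + 1) → ℝ) : Matrix (Fin n) (Fin n) ℂ :=
  ((kMatrix Γ)⁻¹).map (fun x : ℝ => (x : ℂ))

/-- The Hamiltonian of the relative dynamics. -/
def hamiltonian {n : ℕ} (Γ : Fin (n + 1) → ℝ) (μ : ShapeSpace n) : ℝ :=
  -(1 / (4 * Real.pi)) *
    (Γ (Fin.last n) * ∑ i : Fin n, Γ i.castSucc * Real.log (sqDistRef μ i) +
      ∑ i : Fin n, ∑ j ∈ Finset.Ioi i,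
        Γ i.castSucc * Γ j.castSucc * Real.log (sqDist μ i j))

/-- The derivative `δh/δμ`: the element of `𝔳` with
`⟨ν, δh/δμ⟩ = (d/ds) h (μ + s ν)` at `s = 0` for all `ν`. -/
def functionalDerivative {n : ℕ} (h : ShapeSpace n → ℝ) (μ : ShapeSpace n) : ShapeSpace n :=
  gradient h μ

theorem inner_functionalDerivative {n : ℕ} {h : ShapeSpace n → ℝ} {μ : ShapeSpace n}
    (hd : DifferentiableAt ℝ h μ) (ν : ShapeSpace n) :
    HasDerivAt (fun s : ℝ => h (μ + s • ν)) (inner ℝ ν (functionalDerivative h μ)) 0 := by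
  have h1 : HasFDerivAt h (fderiv ℝ h μ) (μ + (0 : ℝ) • ν) := by
    simpa using hd.hasFDerivAt
  have h2 : HasDerivAt (fun s : ℝ => μ + s • ν) ν 0 := by
    simpa using ((hasDerivAt_id (0 : ℝ)).smul_const ν).const_add μ
  have h3 := h1.comp_hasDerivAt (0 : ℝ) h2
  have h4 : inner ℝ ν (functionalDerivative h μ) = fderiv ℝ h μ ν := by
    rw [real_inner_comm, functionalDerivative, gradient, InnerProductSpace.toDual_symm_apply]
  rw [h4]
  exact h3

theorem kInv_conjTranspose {n : ℕ} (Γ : Fin (n + 1) → ℝ) : (kInv Γ)ᴴ = kInv Γ := by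
  have hs : (kMatrix Γ)ᵀ = kMatrix Γ := by
    ext i j
    by_cases h : i = j
    · subst h; rfl
    · simp [kMatrix, h, Ne.symm h, mul_comm]
  have hs' : ((kMatrix Γ)⁻¹)ᵀ = (kMatrix Γ)⁻¹ := by rw [transpose_nonsing_inv, hs]
  ext i j
  have := congrFun (congrFun hs' i) j
  rw [transpose_apply] at this
  simp [kInv, conjTranspose_apply, this]

/-- The Lie–Poisson vector field
`X_h(μ) = -μ (δh/δμ) 𝒦⁻¹ + 𝒦⁻¹ (δh/δμ) μ` for a Hamiltonian `h`. -/
def liePoisson {n : ℕ} (Γ : Fin (n + 1) → ℝ) (h : ShapeSpace n → ℝ) (μ : ShapeSpace n) :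
    ShapeSpace n :=
  ofMatrix
    (-(toMatrix μ * toMatrix (functionalDerivative h μ) * kInv Γ) +
      kInv Γ * toMatrix (functionalDerivative h μ) * toMatrix μ)
    (by
      simp only [conjTranspose_add, conjTranspose_neg, conjTranspose_mul, kInv_conjTranspose,
        conjTranspose_toMatrix, neg_mul, mul_neg, neg_neg, Matrix.mul_assoc]
      abel)

/-- The vector field of the relative dynamics of the vortices. -/
def relativeVectorField {n : ℕ} (Γ : Fin (n + 1) → ℝ) : ShapeSpace n → ShapeSpace n :=
  liePoisson Γ (hamiltonian Γ)

/-- The positions `z_i = q_i - q_N` relative to the last vortex. -/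
def relPosition {n : ℕ} (q : Fin (n + 1) → ℂ) : Fin n → ℂ :=
  fun i => q i.castSucc - q (Fin.last n)

/-- The map `J(z) = i z z*`. -/
def momentumMap {n : ℕ} (z : Fin n → ℂ) : ShapeSpace n :=
  ofMatrix (Complex.I • vecMulVec z (star z)) (by
    ext i j
    simp [vecMulVec_apply, conjTranspose_apply, mul_comm])

/-- `x` is a solution of `x' = X(x)` in the domain `D` on the time set `J`. -/
def IsSolution {E : Type*} [NormedAddCommGroup E] [NormedSpace ℝ E]
    (X : E → E) (D : Set E) (J : Set ℝ) (x : ℝ → E) : Prop :=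
  ∀ t ∈ J, x t ∈ D ∧ HasDerivWithinAt x (X (x t)) J t

/-- Lyapunov stability of the point `x₀` for `x' = X(x)` in the domain `D`: for every `ε > 0`
there is `δ > 0` such that from every initial point `ν ∈ D` that is `δ`-close to `x₀` there
starts a solution for all times `t ≥ 0`, and every solution that starts at `ν` remains
`ε`-close to `x₀` for as long as it exists. -/
def LyapunovStable {E : Type*} [NormedAddCommGroup E] [NormedSpace ℝ E]
    (X : E → E) (D : Set E) (x₀ : E) : Prop :=
  ∀ ε > 0, ∃ δ > 0, ∀ ν ∈ D, dist ν x₀ < δ →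
    (∃ x : ℝ → E, x 0 = ν ∧ IsSolution X D (Set.Ici 0) x) ∧
    ∀ (T : ℝ) (x : ℝ → E), x 0 = ν → IsSolution X D (Set.Ico 0 T) x →
      ∀ t ∈ Set.Ico 0 T, dist (x t) x₀ < ε

/-- Linear instability of the fixed point `x₀` for `x' = X(x)`: the (complexified) linearization
`DX(x₀)` has an eigenvalue with positive real part. -/
def LinearlyUnstable {E : Type*} [NormedAddCommGroup E] [NormedSpace ℝ E]
    (X : E → E) (x₀ : E) : Prop :=
  ∃ A : E →L[ℝ] E, HasFDerivAt X A x₀ ∧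
    ∃ lam : ℂ, 0 < lam.re ∧
      Module.End.HasEigenvalue ((A : E →ₗ[ℝ] E).baseChange ℂ) lam

/-- Four unit vortices and a fifth of circulation `γ`. -/
def squareCirculation (γ : ℝ) : Fin (4 + 1) → ℝ := ![1, 1, 1, 1, γ]

/-- The first four vortices at the vertices of a square, in counterclockwise order and at
distance 1 from the centre, the last one at the centre. -/
def squareConfiguration : Fin (4 + 1) → ℂ := ![1, Complex.I, -1, -Complex.I, 0]

/-- The point of `𝔳` that corresponds to the square with centre. -/
def squareFixedPoint : ShapeSpace 4 := momentumMap (relPosition squareConfiguration)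

end VortexRelative

end

/-! Write `m = [μ_ij]`, `N = -𝒦` and `L = [μ_ij] 𝒦 = -m N`. The relative equation has the Lax form
`L' = [B, L]` with `B = 𝒦⁻¹ δh/δμ`, so `h` and the traces of all powers of `L` are conserved.

Stability. For `γ > 0` the matrix `N` is positive definite. The conserved function `V = (h - h(μ₀))²
+ tr (L² + 4L)² + (tr L + 4)²` is then nonnegative, because `L² + 4L = W N` with `W = m N m - 4m`
Hermitian and `tr (W N W N)` is a squared norm of `W`. If `V = 0`, then `m N m = 4m` and `tr (m N) =
4`, so `m N / 4` is idempotent of trace one. Near `μ₀` it follows that `m = z z*`, where `z` has the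
energy and the angular impulse of the square. The phase of `z` is fixed by making `z 0` real and
positive. The second variation of the energy, corrected by a Lagrange multiplier for the impulse, is
a sum of squares (`squareHessian_eq_sum_squares`) that is definite transversally to rotations for `0
< γ < 9/4`. Hence `z` is the square (`eventually_eq_squareVertices`), and `V` has a strict local
minimum at `μ₀` in the whole of `𝔳`, not only among rank-one matrices. Lyapunov's criterion
`lyapunovStable_of_conserved` applies.

Fixed point and instability. On `z z*` the field is induced by the vortex motion, and the square
rotates uniformly, which `μ` does not see (`relativeVectorField_momentumMap_eq_zero`). A solution
`w` of the variational equation in the rotating frame gives the eigenvector `i (w z* + z w*)` of the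
linearization (`fderiv_relativeVectorField_tangentVec`). Explicit `w` with positive real eigenvalues
exist in the two symmetry blocks where a coefficient of the sum of squares changes sign: `8γ + 4` at
`-1/2` and `γ (36 - 16γ)` at `9/4`. -/

noncomputable section

open Matrix

namespace VortexRelative

/-! ### Complete vector fields and Lyapunov's criterion -/

section Dynamics

open Metric Set Filter Topology
open scoped NNReal

variable {E : Type*} [NormedAddCommGroup E]

/-- A bounded, globally Lipschitz vector field is complete. -/
theorem exists_forall_hasDerivAt_of_lipschitzWith [NormedSpace ℝ E] [CompleteSpace E] {X : E → E}
    {K L : ℝ≥0} (hX : LipschitzWith K X) (hL : ∀ x, ‖X x‖ ≤ L) (x₀ : E) :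
    ∃ x : ℝ → E, x 0 = x₀ ∧ ∀ t, HasDerivAt x (X (x t)) t := by
  have hloc : ∀ a : ℝ, 0 < a → ∃ x : ℝ → E, x 0 = x₀ ∧
      ∀ t ∈ Ioo (-a) a, HasDerivAt x (X (x t)) t := by
    intro a ha
    -- The bounds on `X` are global, so a ball of radius `L * a` may be used; the Picard–Lindelöf
    -- condition on the length of the interval then holds with equality for every `a`.
    have hPL : IsPicardLindelof (fun _ => X) (tmin := -a) (tmax := a)
        ⟨0, by constructor <;> linarith⟩
        x₀ (L * ⟨a, ha.le⟩) 0 L K :=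
      { lipschitzOnWith := fun _ _ => hX.lipschitzOnWith
        continuousOn := fun _ _ => continuousOn_const
        norm_le := fun _ _ x _ => hL x
        mul_max_le := by simp; rfl }
    obtain ⟨x, hx0, hx⟩ := hPL.exists_eq_forall_mem_Icc_hasDerivWithinAt₀
    exact ⟨x, hx0, fun t ht => (hx t (Ioo_subset_Icc_self ht)).hasDerivAt (Icc_mem_nhds ht.1 ht.2)⟩
  choose! α hα0 hα using hloc
  have huniq : ∀ a b : ℝ, 0 < a → a ≤ b → EqOn (α a) (α b) (Ioo (-a) a) := by
    intro a b ha hab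
    refine ODE_solution_unique_of_mem_Ioo (v := fun _ => X) (s := fun _ => univ) (K := K)
      (fun _ _ => hX.lipschitzOnWith) (t₀ := 0) ⟨by linarith, ha⟩
      (fun t ht => ⟨hα a ha t ht, mem_univ _⟩)
      (fun t ht => ⟨hα b (ha.trans_le hab) t ⟨by linarith [ht.1], by linarith [ht.2]⟩,
        mem_univ _⟩) ?_
    rw [hα0 a ha, hα0 b (ha.trans_le hab)]
  -- The local solutions agree by `huniq`, so they glue; the summand `1` keeps `t` in the interior
  -- of the interval of its solution.
  refine ⟨fun t => α (|t| + 1) t, hα0 _ (by positivity), fun t => ?_⟩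
  have hpos : 0 < |t| + 1 := by positivity
  have ht : t ∈ Ioo (-(|t| + 1)) (|t| + 1) :=
    ⟨by linarith [neg_abs_le t], by linarith [le_abs_self t]⟩
  refine (hα _ hpos t ht).congr_of_eventuallyEq ?_
  filter_upwards [Ioo_mem_nhds ht.1 ht.2] with s hs
  have hs' : s ∈ Ioo (-(|s| + 1)) (|s| + 1) :=
    ⟨by linarith [neg_abs_le s], by linarith [le_abs_self s]⟩
  rcases le_total |s| |t| with h | h
  · exact huniq _ _ (by positivity) (by linarith) hs'
  · exact (huniq _ _ hpos (by linarith) hs).symm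

/-- A curve that starts inside a ball and conserves a function which is larger on the boundary
sphere than at the start never leaves the ball. -/
theorem dist_lt_of_conserved [NormedSpace ℝ E] {V : E → ℝ} {x₀ : E} {r T : ℝ} {x : ℝ → E}
    (hT : 0 ≤ T) (hx : ContinuousOn x (Icc 0 T)) (h0 : dist (x 0) x₀ < r)
    (hV : ∀ y, dist y x₀ = r → V (x 0) < V y)
    (hcons : ∀ t ∈ Icc 0 T, dist (x t) x₀ ≤ r → HasDerivWithinAt (V ∘ x) 0 (Icc 0 T) t) :
    dist (x T) x₀ < r := by
  by_contra! hr
  have hd : ContinuousOn (fun t => dist (x t) x₀) (Icc 0 T) :=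
    continuous_dist.comp_continuousOn (hx.prodMk continuousOn_const)
  -- `sInf S` is the first time on the sphere. Up to it the curve is in the closed ball, where `V`
  -- is conserved, which contradicts `hV` there.
  set S : Set ℝ := Icc 0 T ∩ (fun t => dist (x t) x₀) ⁻¹' Ici r with hS
  have hSc : IsClosed S := hd.preimage_isClosed_of_isClosed isClosed_Icc isClosed_Ici
  have hSn : S.Nonempty := ⟨T, ⟨hT, le_rfl⟩, hr⟩
  have hSb : BddBelow S := ⟨0, fun t ht => ht.1.1⟩
  have hτ : sInf S ∈ S := hSc.csInf_mem hSn hSb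
  set τ := sInf S with hτd
  have hlt : ∀ t ∈ Ico 0 τ, dist (x t) x₀ < r := by
    intro t ht
    by_contra! h
    exact absurd (csInf_le hSb (show t ∈ S from ⟨⟨ht.1, ht.2.le.trans hτ.1.2⟩, h⟩)) (not_le.2 ht.2)
  have hsub : Icc 0 τ ⊆ Icc 0 T := Icc_subset_Icc_right hτ.1.2
  obtain ⟨σ, hσ, hσr⟩ := intermediate_value_Icc hτ.1.1 (hd.mono hsub) ⟨h0.le, hτ.2⟩
  have hστ : σ = τ := by
    by_contra h
    exact (hlt σ ⟨hσ.1, lt_of_le_of_ne hσ.2 h⟩).ne hσr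
  subst hστ
  have hτ0 : 0 < τ := by
    rcases hσ.1.eq_or_lt with h | h
    · rw [← h] at hσr
      exact absurd hσr h0.ne
    · exact h
  have hder : ∀ t ∈ Icc 0 τ, HasDerivWithinAt (V ∘ x) 0 (Icc 0 τ) t := by
    intro t ht
    refine (hcons t (hsub ht) ?_).mono hsub
    rcases ht.2.eq_or_lt with h | h
    · rw [h]; exact hσr.le
    · exact (hlt t ⟨ht.1, h⟩).le
  have hconst := constant_of_derivWithin_zero (fun t ht => (hder t ht).differentiableWithinAt)
    (fun t ht => (hder t (Ico_subset_Icc_self ht)).derivWithin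
      (uniqueDiffOn_Icc hτ0 t (Ico_subset_Icc_self ht))) τ ⟨hτ0.le, le_rfl⟩
  exact (hV _ hσr).ne hconst.symm

/-- **Lyapunov's criterion** for a conserved function with a strict local minimum, together with
the global existence of the solutions. -/
theorem lyapunovStable_of_conserved {E : Type*} [NormedAddCommGroup E] [InnerProductSpace ℝ E]
    [FiniteDimensional ℝ E] {X : E → E}
    {D : Set E} {x₀ : E} {V : E → ℝ} (hD : IsOpen D) (hx₀ : x₀ ∈ D)
    (hX : ContDiffOn ℝ 1 X D) (hV0 : V x₀ = 0) (hVpos : ∀ᶠ x in 𝓝 x₀, x ≠ x₀ → 0 < V x)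
    (hcons : ∀ x ∈ D, ∃ V' : E →L[ℝ] ℝ, HasFDerivAt V V' x ∧ V' (X x) = 0) :
    LyapunovStable X D x₀ := by
  have : CompleteSpace E := FiniteDimensional.complete ℝ E
  intro ε hε
  obtain ⟨R, hR, hRb⟩ := Metric.eventually_nhds_iff_ball.1 (hVpos.and (hD.mem_nhds hx₀))
  set r := min (ε / 2) (R / 3) with hr
  have hr0 : 0 < r := by positivity
  have hrε : r < ε := (min_le_left _ _).trans_lt (by linarith)
  have hrR : r ≤ R / 3 := min_le_right _ _
  have hVc : ∀ x ∈ D, ContinuousAt V x := fun x hx =>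
    let ⟨_, h, _⟩ := hcons x hx; h.continuousAt
  have hball : ∀ y, dist y x₀ < R → y ∈ D := fun y hy => (hRb y hy).2
  obtain ⟨c, hc, hcV⟩ : ∃ c > 0, ∀ y, dist y x₀ = r → c ≤ V y := by
    -- The sphere is empty only when `E` is trivial.
    rcases (sphere x₀ r).eq_empty_or_nonempty with h | h
    · refine ⟨1, one_pos, fun y hy => ?_⟩
      have : y ∈ sphere x₀ r := hy
      simp [h] at this
    · obtain ⟨y, hy, hmin⟩ := (isCompact_sphere x₀ r).exists_isMinOn h
        (f := V) (fun z hz => (hVc z (hball z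
          (by rw [mem_sphere] at hz; linarith))).continuousWithinAt)
      refine ⟨V y, ?_, fun z hz => hmin hz⟩
      rw [mem_sphere] at hy
      exact (hRb y (by rw [mem_ball]; linarith)).1 (by rintro rfl; simp at hy; linarith)
  obtain ⟨δ, hδ, hδV⟩ : ∃ δ > 0, ∀ y, dist y x₀ < δ → V y < c := by
    have : ∀ᶠ y in 𝓝 x₀, V y < c :=
        (hVc x₀ hx₀).eventually_lt continuousAt_const (by rw [hV0]; exact hc)
    exact Metric.eventually_nhds_iff.1 this
  refine ⟨min δ r, by positivity, fun ν hν hdist => ⟨?_, ?_⟩⟩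
  -- The cut-off field `χ • X` is complete. It equals `X` on the ball of radius `R / 3`, which the
  -- solution never leaves since `r ≤ R / 3`.
  · let χ : ContDiffBump x₀ := ⟨R / 3, R / 2, by positivity, by linarith⟩
    have hχ : ContDiff ℝ 1 (fun x => χ x • X x) := by
      rw [contDiff_iff_contDiffAt]
      intro x
      by_cases hx : dist x x₀ ≤ R / 2
      · exact χ.contDiffAt.smul
          ((hX x (hball x (by linarith))).contDiffAt (hD.mem_nhds (hball x (by linarith))))
      · refine contDiffAt_const (c := (0 : E)) |>.congr_of_eventuallyEq ?_
        have : ∀ᶠ y in 𝓝 x, R / 2 < dist y x₀ :=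
          (continuous_id.dist continuous_const).continuousAt.eventually (lt_mem_nhds (not_le.1 hx))
        filter_upwards [this] with y hy
        rw [χ.zero_of_le_dist (show R / 2 ≤ dist y x₀ from hy.le), zero_smul]
    have hsupp : HasCompactSupport (fun x => χ x • X x) := χ.hasCompactSupport.smul_right
    obtain ⟨K, hK⟩ := hχ.lipschitzWith_of_hasCompactSupport hsupp one_ne_zero
    obtain ⟨C, hC⟩ := hsupp.exists_bound_of_continuous hχ.continuous
    obtain ⟨x, hx0, hx⟩ := exists_forall_hasDerivAt_of_lipschitzWith hK
      (L := ⟨max C 0, le_max_right _ _⟩) (fun y => (hC y).trans (le_max_left _ _)) ν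
    have hclose : ∀ t, 0 ≤ t → dist (x t) x₀ < r := by
      intro t ht
      refine dist_lt_of_conserved (V := V) ht (fun s _ => (hx s).continuousAt.continuousWithinAt)
        (by rw [hx0]; exact hdist.trans_le (min_le_right _ _))
        (fun y hy => ?_) (fun s _ hs => ?_)
      · rw [hx0]
        exact (hδV ν (hdist.trans_le (min_le_left _ _))).trans_le (hcV y hy)
      · obtain ⟨V', hV', hV'X⟩ := hcons (x s) (hball _ (by linarith))
        have := hV'.comp_hasDerivWithinAt s (hx s).hasDerivWithinAt (s := Icc 0 t)
        simpa [hV'X] using this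
    refine ⟨x, hx0, fun t ht => ⟨hball _ (by linarith [hclose t ht]), ?_⟩⟩
    have h1 : χ (x t) = 1 := χ.one_of_mem_closedBall
      (by rw [mem_closedBall]; exact (hclose t ht).le.trans hrR)
    have := (hx t).hasDerivWithinAt (s := Ici 0)
    simpa [h1] using this
  · intro T x hx0 hx t ht
    have hsub : Icc 0 t ⊆ Ico 0 T := fun s hs => ⟨hs.1, hs.2.trans_lt ht.2⟩
    refine lt_trans (dist_lt_of_conserved (V := V) ht.1
      (fun s hs => ((hx s (hsub hs)).2.continuousWithinAt).mono hsub)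
      (by rw [hx0]; exact hdist.trans_le (min_le_right _ _))
      (fun y hy => ?_) (fun s hs _ => ?_)) hrε
    · rw [hx0]
      exact (hδV ν (hdist.trans_le (min_le_left _ _))).trans_le (hcV y hy)
    · obtain ⟨V', hV', hV'X⟩ := hcons (x s) (hx s (hsub hs)).1
      have := hV'.comp_hasDerivWithinAt s ((hx s (hsub hs)).2.mono hsub)
      simpa [hV'X] using this

end Dynamics

open ShapeSpace Set Filter Topology

/-! ### The gradient of the Hamiltonian -/

theorem toMatrix_momentumMap {n : ℕ} (z : Fin n → ℂ) :
    toMatrix (momentumMap z) = Complex.I • vecMulVec z (star z) := rfl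

theorem toMatrix_apply_swap {n : ℕ} (μ : ShapeSpace n) (i j : Fin n) :
    toMatrix μ j i = -star (toMatrix μ i j) := by
  have h := congrFun (congrFun (conjTranspose_toMatrix μ) j) i
  rw [conjTranspose_apply, Matrix.neg_apply] at h
  rw [h, neg_neg]

theorem inner_momentumMap {n : ℕ} (z : Fin n → ℂ) (μ : ShapeSpace n) :
    inner ℝ (momentumMap z) μ = 1 / 2 * (-Complex.I * (star z ⬝ᵥ toMatrix μ *ᵥ z)).re := by
  rw [inner_def, toMatrix_momentumMap, conjTranspose_smul, conjTranspose_vecMulVec, star_star,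
    smul_mul, trace_smul, vecMulVec_mul, trace_vecMulVec, dotProduct_comm,
    ← dotProduct_mulVec]
  simp

/-- The Riesz representative of `sqDistRef · i`. -/
def sqDistRefVec {n : ℕ} (i : Fin n) : ShapeSpace n :=
  (2 : ℝ) • momentumMap (Pi.single i 1)

/-- The Riesz representative of `sqDist · i j`. -/
def sqDistVec {n : ℕ} (i j : Fin n) : ShapeSpace n :=
  (2 : ℝ) • momentumMap (Pi.single i 1 - Pi.single j 1)

theorem inner_sqDistRefVec {n : ℕ} (i : Fin n) (μ : ShapeSpace n) :
    inner ℝ (sqDistRefVec i) μ = sqDistRef μ i := by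
  rw [sqDistRefVec, real_inner_smul_left, inner_momentumMap, sqDistRef, entry]
  simp [Pi.star_single]

theorem inner_sqDistVec {n : ℕ} (i j : Fin n) (μ : ShapeSpace n) :
    inner ℝ (sqDistVec i j) μ = sqDist μ i j := by
  rw [sqDistVec, real_inner_smul_left, inner_momentumMap, sqDist, sqDistRef, sqDistRef, entry,
    entry, entry]
  have h := toMatrix_apply_swap μ i j
  simp [Pi.star_single, mulVec_sub, sub_dotProduct, dotProduct_sub, h]
  ring

/-- The gradient of the Hamiltonian, in closed form. -/
def hamiltonianGradient {n : ℕ} (Γ : Fin (n + 1) → ℝ) (μ : ShapeSpace n) : ShapeSpace n :=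
  -(1 / (4 * Real.pi)) •
    (Γ (Fin.last n) • ∑ i : Fin n, (Γ i.castSucc / sqDistRef μ i) • sqDistRefVec i +
      ∑ i : Fin n, ∑ j ∈ Finset.Ioi i,
        (Γ i.castSucc * Γ j.castSucc / sqDist μ i j) • sqDistVec i j)

theorem hasFDerivAt_const_mul_log_inner {E : Type*} [NormedAddCommGroup E]
    [InnerProductSpace ℝ E] [CompleteSpace E] (c : ℝ) {e x : E} (h : inner ℝ e x ≠ (0 : ℝ)) :
    HasFDerivAt (fun y => c * Real.log (inner ℝ e y))
      (InnerProductSpace.toDual ℝ E ((c / inner ℝ e x) • e)) x := by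
  have h1 : HasFDerivAt (fun y : E => inner ℝ e y) (innerSL ℝ e) x := (innerSL ℝ e).hasFDerivAt
  have h2 := (h1.log h).const_mul c
  refine h2.congr_fderiv ?_
  ext v
  simp [div_eq_mul_inv]
  ring

theorem hasGradientAt_hamiltonian {n : ℕ} (Γ : Fin (n + 1) → ℝ) {μ : ShapeSpace n}
    (hμ : μ ∈ collisionFree n) :
    HasGradientAt (hamiltonian Γ) (hamiltonianGradient Γ μ) μ := by
  have h1 : ∀ i : Fin n, HasFDerivAt (fun y => Γ i.castSucc * Real.log (sqDistRef y i))
      (InnerProductSpace.toDual ℝ _ ((Γ i.castSucc / sqDistRef μ i) • sqDistRefVec i)) μ := by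
    intro i
    have := hasFDerivAt_const_mul_log_inner (Γ i.castSucc) (e := sqDistRefVec i) (x := μ)
      (by rw [inner_sqDistRefVec]; exact (hμ.1 i).ne')
    simpa only [inner_sqDistRefVec] using this
  have h2 : ∀ i : Fin n, ∀ j ∈ Finset.Ioi i,
      HasFDerivAt (fun y => Γ i.castSucc * Γ j.castSucc * Real.log (sqDist y i j))
      (InnerProductSpace.toDual ℝ _
        ((Γ i.castSucc * Γ j.castSucc / sqDist μ i j) • sqDistVec i j)) μ := by
    intro i j hij
    have := hasFDerivAt_const_mul_log_inner (Γ i.castSucc * Γ j.castSucc) (e := sqDistVec i j)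
      (x := μ) (by rw [inner_sqDistVec]; exact (hμ.2 i j (Finset.mem_Ioi.1 hij)).ne')
    simpa only [inner_sqDistVec] using this
  have h3 := (((HasFDerivAt.fun_sum fun i (_ : i ∈ Finset.univ) => h1 i).const_mul
    (Γ (Fin.last n))).add (HasFDerivAt.fun_sum fun i (_ : i ∈ Finset.univ) =>
      HasFDerivAt.fun_sum (h2 i))).const_mul (-(1 / (4 * Real.pi)))
  rw [hasGradientAt_iff_hasFDerivAt]
  refine h3.congr_fderiv ?_
  ext v
  simp [hamiltonianGradient]

theorem functionalDerivative_hamiltonian {n : ℕ} (Γ : Fin (n + 1) → ℝ) {μ : ShapeSpace n}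
    (hμ : μ ∈ collisionFree n) :
    functionalDerivative (hamiltonian Γ) μ = hamiltonianGradient Γ μ :=
  (hasGradientAt_hamiltonian Γ hμ).gradient

theorem continuous_sqDistRef {n : ℕ} (i : Fin n) :
    Continuous fun μ : ShapeSpace n => sqDistRef μ i := by
  simp only [← inner_sqDistRefVec]
  fun_prop

theorem continuous_sqDist {n : ℕ} (i j : Fin n) :
    Continuous fun μ : ShapeSpace n => sqDist μ i j := by
  simp only [← inner_sqDistVec]
  fun_prop

theorem isOpen_collisionFree (n : ℕ) : IsOpen (collisionFree n) := by
  simp only [collisionFree, ofPred_and, ofPred_forall]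
  refine (isOpen_iInter_of_finite fun i => ?_).inter (isOpen_iInter_of_finite fun i =>
    isOpen_iInter_of_finite fun j => isOpen_iInter_of_finite fun _ => ?_)
  · exact isOpen_lt continuous_const (continuous_sqDistRef i)
  · exact isOpen_lt continuous_const (continuous_sqDist i j)

theorem contDiffOn_hamiltonianGradient {n : ℕ} (Γ : Fin (n + 1) → ℝ) :
    ContDiffOn ℝ 1 (hamiltonianGradient Γ) (collisionFree n) := by
  intro μ hμ
  apply ContDiffAt.contDiffWithinAt
  unfold hamiltonianGradient
  have h1 : ∀ i, ContDiffAt ℝ 1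
      (fun ν => (Γ i.castSucc / sqDistRef ν i) • sqDistRefVec i) μ := by
    intro i
    have h : ContDiffAt ℝ 1 (fun ν : ShapeSpace n => sqDistRef ν i) μ := by
      simp only [← inner_sqDistRefVec]
      exact contDiffAt_const.inner ℝ contDiffAt_id
    have h' : ContDiffAt ℝ 1 (fun ν : ShapeSpace n => Γ i.castSucc / sqDistRef ν i) μ :=
      contDiffAt_const.div h (hμ.1 i).ne'
    exact h'.smul contDiffAt_const
  have h2 : ∀ i, ∀ j ∈ Finset.Ioi i, ContDiffAt ℝ 1
      (fun ν => (Γ i.castSucc * Γ j.castSucc / sqDist ν i j) • sqDistVec i j) μ := by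
    intro i j hj
    have h : ContDiffAt ℝ 1 (fun ν : ShapeSpace n => sqDist ν i j) μ := by
      simp only [← inner_sqDistVec]
      exact contDiffAt_const.inner ℝ contDiffAt_id
    have h' : ContDiffAt ℝ 1
        (fun ν : ShapeSpace n => Γ i.castSucc * Γ j.castSucc / sqDist ν i j) μ :=
      contDiffAt_const.div h (hμ.2 i j (Finset.mem_Ioi.1 hj)).ne'
    exact h'.smul contDiffAt_const
  exact (((ContDiffAt.sum fun i _ => h1 i).const_smul _).add
    (ContDiffAt.sum fun i _ => ContDiffAt.sum (h2 i))).const_smul _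

/-! ### Smoothness of the vector field, in the full matrix algebra -/

section MatrixNorm

attribute [local instance] Matrix.linftyOpNormedRing Matrix.linftyOpNormedAlgebra

/-- The inclusion of `𝔳` into the matrices, as a continuous linear map. -/
def toMatrixL (n : ℕ) : ShapeSpace n →L[ℝ] Matrix (Fin n) (Fin n) ℂ :=
  LinearMap.toContinuousLinearMap (toMatrix (n := n))

/-- A continuous linear left inverse of the inclusion of `𝔳` into the matrices. -/
theorem exists_leftInverse_toMatrixL (n : ℕ) :
    ∃ p : Matrix (Fin n) (Fin n) ℂ →L[ℝ] ShapeSpace n, ∀ μ, p (toMatrix μ) = μ := by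
  obtain ⟨g, hg⟩ := LinearMap.exists_leftInverse_of_injective (toMatrix (n := n))
    (LinearMap.ker_eq_bot.2 toMatrix_injective)
  exact ⟨LinearMap.toContinuousLinearMap g, fun μ => LinearMap.congr_fun hg μ⟩

/-- The factors of the products do not stay in `𝔳`, so smoothness is shown for matrices and brought
back to `𝔳` by the left inverse `p`. -/
theorem contDiffOn_relativeVectorField {n : ℕ} (Γ : Fin (n + 1) → ℝ) :
    ContDiffOn ℝ 1 (relativeVectorField Γ) (collisionFree n) := by
  obtain ⟨p, hp⟩ := exists_leftInverse_toMatrixL n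
  have hg : ContDiffOn ℝ 1 (fun μ => toMatrixL n (hamiltonianGradient Γ μ)) (collisionFree n) :=
    (toMatrixL n).contDiff.comp_contDiffOn (contDiffOn_hamiltonianGradient Γ)
  have hm : ContDiffOn ℝ 1 (fun μ => toMatrixL n μ) (collisionFree n) :=
    (toMatrixL n).contDiff.contDiffOn
  have h := p.contDiff.comp_contDiffOn
    (((hm.mul hg).mul (contDiffOn_const (c := kInv Γ))).neg.add
      (((contDiffOn_const (c := kInv Γ)).mul hg).mul hm))
  refine h.congr fun μ hμ => ?_
  rw [← hp (relativeVectorField Γ μ), relativeVectorField, liePoisson, toMatrix_ofMatrix,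
    functionalDerivative_hamiltonian Γ hμ]
  rfl

/-! ### Conserved quantities -/

/-- Real part of the trace, as a continuous linear map. -/
def reTrace (n : ℕ) : Matrix (Fin n) (Fin n) ℂ →L[ℝ] ℝ :=
  LinearMap.toContinuousLinearMap
    (Complex.reLm ∘ₗ (traceLinearMap (Fin n) ℝ ℂ : Matrix (Fin n) (Fin n) ℂ →ₗ[ℝ] ℂ))

theorem reTrace_apply {n : ℕ} (A : Matrix (Fin n) (Fin n) ℂ) : reTrace n A = A.trace.re := rfl

theorem reTrace_commutator {n : ℕ} (A B : Matrix (Fin n) (Fin n) ℂ) :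
    reTrace n (B * A - A * B) = 0 := by
  rw [reTrace_apply, trace_sub, trace_mul_comm, sub_self, Complex.zero_re]

theorem hasDerivAt_reTrace_of_lax {n : ℕ} {P : ℝ → Matrix (Fin n) (Fin n) ℂ}
    {B : Matrix (Fin n) (Fin n) ℂ} {t : ℝ} (hP : HasDerivAt P (B * P t - P t * B) t) :
    HasDerivAt (fun s => reTrace n (P s)) 0 t := by
  exact ((reTrace n).hasFDerivAt.comp_hasDerivAt t hP).congr_deriv (reTrace_commutator _ _)

/-- The commutator with `B` is a derivation, so Lax equations with the same `B` are stable under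
products; every trace of a polynomial in `L` is therefore conserved. -/
theorem hasDerivAt_mul_of_lax {n : ℕ} {P Q : ℝ → Matrix (Fin n) (Fin n) ℂ}
    {B : Matrix (Fin n) (Fin n) ℂ} {t : ℝ} (hP : HasDerivAt P (B * P t - P t * B) t)
    (hQ : HasDerivAt Q (B * Q t - Q t * B) t) :
    HasDerivAt (fun s => P s * Q s) (B * (P t * Q t) - P t * Q t * B) t := by
  refine (hP.mul hQ).congr_deriv ?_
  noncomm_ring

theorem hasDerivAt_add_smul_of_lax {n : ℕ} {P Q : ℝ → Matrix (Fin n) (Fin n) ℂ}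
    {B : Matrix (Fin n) (Fin n) ℂ} {t : ℝ} (c : ℝ) (hP : HasDerivAt P (B * P t - P t * B) t)
    (hQ : HasDerivAt Q (B * Q t - Q t * B) t) :
    HasDerivAt (fun s => P s + c • Q s) (B * (P t + c • Q t) - (P t + c • Q t) * B) t := by
  refine (hP.add (hQ.const_smul c)).congr_deriv ?_
  rw [mul_add, add_mul, mul_smul_comm, smul_mul_assoc, smul_sub]
  abel

/-- `𝒦`, as a complex matrix. -/
def kMatrixC {n : ℕ} (Γ : Fin (n + 1) → ℝ) : Matrix (Fin n) (Fin n) ℂ :=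
  (kMatrix Γ).map (fun x : ℝ => (x : ℂ))

theorem kMatrixC_mul_kInv {n : ℕ} {Γ : Fin (n + 1) → ℝ} (hK : IsUnit (kMatrix Γ).det) :
    kMatrixC Γ * kInv Γ = 1 := by
  have h := congrArg (fun M => M.map (Complex.ofRealHom)) (mul_nonsing_inv _ hK)
  simp only [Matrix.map_mul, Matrix.map_one _ (map_zero _) (map_one _)] at h
  exact h

theorem kInv_mul_kMatrixC {n : ℕ} {Γ : Fin (n + 1) → ℝ} (hK : IsUnit (kMatrix Γ).det) :
    kInv Γ * kMatrixC Γ = 1 := by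
  have h := congrArg (fun M => M.map (Complex.ofRealHom)) (nonsing_inv_mul _ hK)
  simp only [Matrix.map_mul, Matrix.map_one _ (map_zero _) (map_one _)] at h
  exact h

/-- The matrix `[μ_{ij}] 𝒦`, whose spectrum the relative dynamics preserves. -/
def laxMatrix {n : ℕ} (Γ : Fin (n + 1) → ℝ) (μ : ShapeSpace n) : Matrix (Fin n) (Fin n) ℂ :=
  (-Complex.I) • toMatrix μ * kMatrixC Γ

/-- Multiplication by `𝒦` on the right cancels the `𝒦⁻¹` at the end of the first term of the field,
and `𝒦 𝒦⁻¹ = 1` can be inserted in the other term of the commutator. -/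
theorem hasDerivAt_laxMatrix {n : ℕ} {Γ : Fin (n + 1) → ℝ} (hK : IsUnit (kMatrix Γ).det)
    {h : ShapeSpace n → ℝ} {x : ℝ → ShapeSpace n} {t : ℝ}
    (hx : HasDerivAt x (liePoisson Γ h (x t)) t) :
    HasDerivAt (fun s => laxMatrix Γ (x s))
      (kInv Γ * toMatrix (functionalDerivative h (x t)) * laxMatrix Γ (x t) -
        laxMatrix Γ (x t) * (kInv Γ * toMatrix (functionalDerivative h (x t)))) t := by
  have h1 : HasDerivAt (fun s => toMatrix (x s)) (toMatrix (liePoisson Γ h (x t))) t :=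
    (toMatrixL n).hasFDerivAt.comp_hasDerivAt t hx
  have h2 := (h1.const_smul (-Complex.I)).mul_const (kMatrixC Γ)
  refine h2.congr_deriv ?_
  have e1 := kInv_mul_kMatrixC hK
  have e2 := kMatrixC_mul_kInv hK
  simp only [laxMatrix, liePoisson, toMatrix_ofMatrix]
  simp only [smul_add, smul_neg, add_mul, neg_mul, smul_mul_assoc, mul_smul_comm, Matrix.mul_assoc,
    e1, Matrix.mul_one]
  rw [← Matrix.mul_assoc (kMatrixC Γ), e2, Matrix.one_mul]
  abel

theorem contDiff_laxMatrix {n : ℕ} (Γ : Fin (n + 1) → ℝ) :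
    ContDiff ℝ 1 (laxMatrix Γ) :=
  ((contDiff_const (c := -Complex.I)).smul (toMatrixL n).contDiff).mul contDiff_const

/-- Conservation of energy: with `G = δh/δμ`, cyclicity of the trace gives `tr (G μ G 𝒦⁻¹) = tr (G
𝒦⁻¹ G μ)`. -/
theorem inner_functionalDerivative_liePoisson {n : ℕ} (Γ : Fin (n + 1) → ℝ)
    (h : ShapeSpace n → ℝ) (μ : ShapeSpace n) :
    inner ℝ (functionalDerivative h μ) (liePoisson Γ h μ) = 0 := by
  rw [inner_def, conjTranspose_toMatrix, liePoisson, toMatrix_ofMatrix]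
  set G := toMatrix (functionalDerivative h μ)
  set M := toMatrix μ
  have : (G * (M * G * kInv Γ)).trace = (G * (kInv Γ * G * M)).trace := by
    rw [trace_mul_comm, trace_mul_comm G (kInv Γ * G * M), trace_mul_comm (kInv Γ * G * M) G,
      trace_mul_comm (M * G * kInv Γ) G]
    rw [← Matrix.mul_assoc, ← Matrix.mul_assoc, trace_mul_comm]
    rw [show G * (kInv Γ * G * M) = (G * (kInv Γ)) * (G * M) by simp only [Matrix.mul_assoc],
      trace_mul_comm (G * kInv Γ)]
    rw [trace_mul_comm]
    simp only [Matrix.mul_assoc]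
  simp [mul_add, this]

end MatrixNorm

/-! ### The energy of the vortices near the square with centre -/

/-- The remainder of `log |1 + u|²` after the terms of second order. -/
def logRemainder (u : ℂ) : ℝ :=
  Real.log (Complex.normSq (1 + u)) - (2 * u.re - (u ^ 2).re)

theorem logRemainder_isLittleO : logRemainder =o[𝓝 0] fun u : ℂ => ‖u‖ ^ 2 := by
  have hO : logRemainder =O[𝓝 0] fun u : ℂ => ‖u‖ ^ 3 := by
    refine Asymptotics.IsBigO.of_bound 2 ?_
    filter_upwards [Metric.ball_mem_nhds (0 : ℂ) (half_pos one_pos)] with u hu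
    rw [mem_ball_zero_iff] at hu
    -- `log |1 + u|² = 2 Re log (1 + u)`. The index `2` refers to `logTaylor 3`, the terms of degree
    -- less than three, with an error of order `‖u‖ ^ 3`.
    have h := Complex.norm_log_sub_logTaylor_le 2 (hu.trans (by norm_num))
    have hT : Complex.logTaylor 3 u = u - u ^ 2 / 2 := by
      simp [Complex.logTaylor, Finset.sum_range_succ]
      ring
    have hrem : logRemainder u = 2 * (Complex.log (1 + u) - Complex.logTaylor 3 u).re := by
      rw [hT, logRemainder, Complex.sub_re, Complex.log_re, Complex.normSq_eq_norm_sq, Real.log_pow]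
      simp
      ring
    have hinv : (1 - ‖u‖)⁻¹ ≤ 2 := by
      rw [inv_le_comm₀ (by linarith) two_pos]
      linarith
    have h3 : ‖u‖ ^ 3 * (1 - ‖u‖)⁻¹ ≤ ‖u‖ ^ 3 * 2 := by gcongr
    rw [hrem, norm_mul, Real.norm_eq_abs, Real.norm_eq_abs, abs_two, norm_pow, norm_norm]
    have h4 := (Complex.abs_re_le_norm _).trans h
    norm_num at h4
    rw [← Complex.sub_re] at h4
    nlinarith [pow_nonneg (norm_nonneg u) 3]
  refine hO.trans_isLittleO ?_
  have h1 : (fun u : ℂ => ‖u‖) =o[𝓝 0] fun _ : ℂ => (1 : ℝ) :=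
    (Asymptotics.isLittleO_one_iff ℝ).2 (by simpa using (continuous_norm (E := ℂ)).tendsto 0)
  have h2 := h1.mul_isBigO (Asymptotics.isBigO_refl (fun u : ℂ => ‖u‖ ^ 2) (𝓝 0))
  simpa only [← pow_succ', one_mul] using h2

theorem logRemainder_comp_isLittleO {E : Type*} [NormedAddCommGroup E] [NormedSpace ℝ E]
    (l : E →L[ℝ] ℂ) (a : ℂ) : (fun v => logRemainder (l v / a)) =o[𝓝 0] fun v : E => ‖v‖ ^ 2 := by
  have hO : (fun v => l v / a) =O[𝓝 0] fun v : E => ‖v‖ := by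
    simp only [div_eq_inv_mul]
    exact ((l.isBigO_id _).const_mul_left _).norm_right
  have ht : Tendsto (fun v => l v / a) (𝓝 0) (𝓝 0) := by
    have : Continuous fun v => l v / a := by fun_prop
    simpa using this.tendsto 0
  exact (logRemainder_isLittleO.comp_tendsto ht).trans_isBigO (hO.norm_left.pow 2)

theorem log_normSq_add {a : ℂ} (ha : a ≠ 0) {v : ℂ} (hv : a + v ≠ 0) :
    Real.log (Complex.normSq (a + v)) = Real.log (Complex.normSq a) +
      (2 * (v / a).re - ((v / a) ^ 2).re) + logRemainder (v / a) := by
  have h : a + v = a * (1 + v / a) := by field_simp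
  have h1 : 1 + v / a ≠ 0 := fun h0 => hv (by rw [h, h0, mul_zero])
  rw [h, Complex.normSq_mul, Real.log_mul (by simpa using ha) (by simpa using h1), logRemainder]
  ring

/-- Up to a factor, the energy of four unit vortices at `z` and a vortex of circulation `γ` at
the origin. -/
def squareEnergy (γ : ℝ) (z : Fin 4 → ℂ) : ℝ :=
  γ * ∑ i, Real.log (Complex.normSq (z i)) +
    ∑ i, ∑ j ∈ Finset.Ioi i, Real.log (Complex.normSq (z i - z j))

/-- The angular impulse of four unit vortices at `z` and a vortex of circulation `γ` at the
origin, relative to the centre of circulation. -/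
def squareImpulse (γ : ℝ) (z : Fin 4 → ℂ) : ℝ :=
  ∑ i, Complex.normSq (z i) - Complex.normSq (∑ i, z i) / (γ + 4)

/-- The vertices of the square. -/
def squareVertices : Fin 4 → ℂ := ![1, Complex.I, -1, -Complex.I]

/-- Half of the Hessian of the energy, constrained to a level of the impulse. -/
def squareHessian (γ : ℝ) (v : Fin 4 → ℂ) : ℝ :=
  -γ * ∑ i, ((v i / squareVertices i) ^ 2).re -
    ∑ i, ∑ j ∈ Finset.Ioi i, (((v i - v j) / (squareVertices i - squareVertices j)) ^ 2).re -
    (γ + 3 / 2) * squareImpulse γ v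

theorem squareVertices_ne_zero (i : Fin 4) : squareVertices i ≠ 0 := by
  fin_cases i <;> simp [squareVertices]

theorem squareVertices_sub_ne_zero {i j : Fin 4} (h : i < j) :
    squareVertices i - squareVertices j ≠ 0 := by
  fin_cases i <;> fin_cases j <;>
    first
    | exact absurd h (by decide)
    | (simp [squareVertices, Complex.ext_iff]; try norm_num)

theorem Ioi_fin_four : Finset.Ioi (0 : Fin 4) = {1, 2, 3} ∧ Finset.Ioi (1 : Fin 4) = {2, 3} ∧
    Finset.Ioi (2 : Fin 4) = {3} ∧ Finset.Ioi (3 : Fin 4) = ∅ := by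
  decide

theorem sum_Ioi_fin_four (f : Fin 4 → Fin 4 → ℝ) : ∑ i, ∑ j ∈ Finset.Ioi i, f i j =
    f 0 1 + f 0 2 + f 0 3 + f 1 2 + f 1 3 + f 2 3 := by
  obtain ⟨h0, h1, h2, h3⟩ := Ioi_fin_four
  rw [Fin.sum_univ_four, h0, h1, h2, h3]
  rw [Finset.sum_insert (by decide), Finset.sum_insert (by decide), Finset.sum_insert (by decide)]
  simp
  ring

theorem div_squareVertices (w : ℂ) : w / squareVertices 0 = w ∧
    w / squareVertices 1 = -Complex.I * w ∧ w / squareVertices 2 = -w ∧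
    w / squareVertices 3 = Complex.I * w := by
  refine ⟨?_, ?_, ?_, ?_⟩ <;> simp [squareVertices, div_eq_mul_inv, mul_comm]

theorem div_squareVertices_sub (w : ℂ) :
    w / (squareVertices 0 - squareVertices 1) = (1 + Complex.I) / 2 * w ∧
    w / (squareVertices 0 - squareVertices 2) = 1 / 2 * w ∧
    w / (squareVertices 0 - squareVertices 3) = (1 - Complex.I) / 2 * w ∧
    w / (squareVertices 1 - squareVertices 2) = (1 - Complex.I) / 2 * w ∧
    w / (squareVertices 1 - squareVertices 3) = -Complex.I / 2 * w ∧
    w / (squareVertices 2 - squareVertices 3) = (-1 - Complex.I) / 2 * w := by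
  have hI : Complex.I ^ 2 = -1 := Complex.I_sq
  refine ⟨?_, ?_, ?_, ?_, ?_, ?_⟩ <;> rw [div_eq_iff (squareVertices_sub_ne_zero (by decide))] <;>
    simp [squareVertices] <;> grind

theorem sum_sq_div_squareVertices (v : Fin 4 → ℂ) :
    ∑ i, ((v i / squareVertices i) ^ 2).re =
      (v 0).re ^ 2 - (v 0).im ^ 2 - (v 1).re ^ 2 + (v 1).im ^ 2 + (v 2).re ^ 2 - (v 2).im ^ 2 -
        (v 3).re ^ 2 + (v 3).im ^ 2 := by
  rw [Fin.sum_univ_four, (div_squareVertices (v 0)).1, (div_squareVertices (v 1)).2.1,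
    (div_squareVertices (v 2)).2.2.1, (div_squareVertices (v 3)).2.2.2]
  simp [pow_two]
  ring

theorem sum_re_div_squareVertices (v : Fin 4 → ℂ) :
    ∑ i, (v i / squareVertices i).re = (v 0).re + (v 1).im - (v 2).re - (v 3).im := by
  rw [Fin.sum_univ_four, (div_squareVertices (v 0)).1, (div_squareVertices (v 1)).2.1,
    (div_squareVertices (v 2)).2.2.1, (div_squareVertices (v 3)).2.2.2]
  simp
  ring

/-- The same linear form as for the distances to the centre, and half the linear part of the
impulse: the square is a critical point of the energy at fixed impulse. The multiplier `γ + 3 / 2`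
in `squareHessian` comes from here. -/
theorem sum_re_div_squareVertices_sub (v : Fin 4 → ℂ) :
    ∑ i, ∑ j ∈ Finset.Ioi i, ((v i - v j) / (squareVertices i - squareVertices j)).re =
      3 / 2 * ((v 0).re + (v 1).im - (v 2).re - (v 3).im) := by
  rw [sum_Ioi_fin_four fun i j => ((v i - v j) / (squareVertices i - squareVertices j)).re,
    (div_squareVertices_sub _).1, (div_squareVertices_sub _).2.1,
    (div_squareVertices_sub _).2.2.1, (div_squareVertices_sub _).2.2.2.1,
    (div_squareVertices_sub _).2.2.2.2.1, (div_squareVertices_sub _).2.2.2.2.2]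
  simp
  ring

theorem sum_sq_div_squareVertices_sub (v : Fin 4 → ℂ) :
    4 * ∑ i, ∑ j ∈ Finset.Ioi i, (((v i - v j) / (squareVertices i - squareVertices j)) ^ 2).re =
      ((v 0).re - (v 2).re) ^ 2 - ((v 0).im - (v 2).im) ^ 2 - ((v 1).re - (v 3).re) ^ 2 +
        ((v 1).im - (v 3).im) ^ 2 +
        4 * (((v 0).re - (v 3).re) * ((v 0).im - (v 3).im) -
          ((v 0).re - (v 1).re) * ((v 0).im - (v 1).im) +
          ((v 1).re - (v 2).re) * ((v 1).im - (v 2).im) -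
          ((v 2).re - (v 3).re) * ((v 2).im - (v 3).im)) := by
  rw [sum_Ioi_fin_four fun i j => (((v i - v j) / (squareVertices i - squareVertices j)) ^ 2).re,
    (div_squareVertices_sub _).1, (div_squareVertices_sub _).2.1,
    (div_squareVertices_sub _).2.2.1, (div_squareVertices_sub _).2.2.2.1,
    (div_squareVertices_sub _).2.2.2.2.1, (div_squareVertices_sub _).2.2.2.2.2]
  simp [pow_two]
  ring

/-- The impulse is quadratic and the vertices sum to zero, so its expansion at the square is exact.
On the level `squareImpulse = 4` the linear terms of the energy are thus replaced exactly by a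
quadratic form. -/
theorem squareHessian_eq {γ : ℝ} (hγ : γ + 4 ≠ 0) (v : Fin 4 → ℂ) :
    γ * ∑ i, (2 * (v i / squareVertices i).re - ((v i / squareVertices i) ^ 2).re) +
      ∑ i, ∑ j ∈ Finset.Ioi i,
        (2 * ((v i - v j) / (squareVertices i - squareVertices j)).re -
          (((v i - v j) / (squareVertices i - squareVertices j)) ^ 2).re) =
    squareHessian γ v + (γ + 3 / 2) * (squareImpulse γ (squareVertices + v) - 4) := by
  rw [Finset.sum_sub_distrib, ← Finset.mul_sum, sum_re_div_squareVertices]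
  simp only [Finset.sum_sub_distrib, ← Finset.mul_sum, sum_re_div_squareVertices_sub]
  simp only [squareHessian, squareImpulse, Fin.sum_univ_four, squareVertices, Complex.normSq_apply,
    Pi.add_apply]
  simp
  field_simp
  ring

/-- The linear forms are the Fourier modes of the symmetry group of the square. The missing eighth
form is the one detecting infinitesimal rotations. The modes that move opposite vertices in parallel
are coupled, and completing squares leaves the coefficient with `36 - 16 * γ`, which gives the
threshold `9 / 4`. -/
theorem squareHessian_eq_sum_squares {γ : ℝ} (hγ : γ + 4 ≠ 0) (hγ' : 4 * γ + 6 ≠ 0)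
    (v : Fin 4 → ℂ) :
    -16 * squareHessian γ v =
      2 * (4 * γ + 6) * ((v 0).re + (v 1).im - (v 2).re - (v 3).im) ^ 2 +
      (8 * γ + 4) * ((v 0).re - (v 1).im - (v 2).re + (v 3).im) ^ 2 +
      8 * ((v 0).im + (v 1).re - (v 2).im - (v 3).re) ^ 2 +
      (4 * γ + 6) * (((v 0).re - (v 1).re + (v 2).re - (v 3).re) +
        4 * γ / (4 * γ + 6) * ((v 0).re + (v 1).re + (v 2).re + (v 3).re)) ^ 2 +
      (4 * γ + 6) * (((v 0).im - (v 1).im + (v 2).im - (v 3).im) -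
        4 * γ / (4 * γ + 6) * ((v 0).im + (v 1).im + (v 2).im + (v 3).im)) ^ 2 +
      γ * (36 - 16 * γ) / ((4 * γ + 6) * (γ + 4)) *
        (((v 0).re + (v 1).re + (v 2).re + (v 3).re) ^ 2 +
          ((v 0).im + (v 1).im + (v 2).im + (v 3).im) ^ 2) := by
  -- `B` is an alternating sum and `C` the sum of the same coordinates; for imaginary parts the
  -- coupling has the opposite sign, hence the sign of the second argument in `e2`.
  have key : ∀ B C : ℝ, (4 * γ + 6) * (B + 4 * γ / (4 * γ + 6) * C) ^ 2 +
      γ * (36 - 16 * γ) / ((4 * γ + 6) * (γ + 4)) * C ^ 2 =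
      (4 * γ + 6) * B ^ 2 + 8 * γ * B * C + (4 * γ + 6) * γ / (γ + 4) * C ^ 2 := by
    intro B C
    field_simp
    ring
  have hr : (4 * γ + 6) * γ / (γ + 4) = (4 * γ + 6) - 4 * (4 * γ + 6) * (1 / (γ + 4)) := by
    field_simp
    ring
  have e1 := key ((v 0).re - (v 1).re + (v 2).re - (v 3).re)
    ((v 0).re + (v 1).re + (v 2).re + (v 3).re)
  have e2 := key ((v 0).im - (v 1).im + (v 2).im - (v 3).im)
    (-((v 0).im + (v 1).im + (v 2).im + (v 3).im))
  have h := sum_sq_div_squareVertices_sub v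
  have h' : squareImpulse γ v = ∑ i, ((v i).re ^ 2 + (v i).im ^ 2) -
      ((∑ i, (v i).re) ^ 2 + (∑ i, (v i).im) ^ 2) * (1 / (γ + 4)) := by
    simp only [squareImpulse, Complex.normSq_apply, Complex.re_sum, Complex.im_sum, pow_two]
    ring
  simp only [Fin.sum_univ_four] at h'
  rw [hr] at e1 e2
  rw [squareHessian, sum_sq_div_squareVertices, h']
  linear_combination 4 * h - e1 - e2

theorem eq_zero_of_sum_six_nonpos {a b c d e f : ℝ} (ha : 0 ≤ a) (hb : 0 ≤ b) (hc : 0 ≤ c)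
    (hd : 0 ≤ d) (he : 0 ≤ e) (hf : 0 ≤ f) (h : a + b + c + d + e + f ≤ 0) :
    a = 0 ∧ b = 0 ∧ c = 0 ∧ d = 0 ∧ e = 0 ∧ f = 0 := by
  refine ⟨?_, ?_, ?_, ?_, ?_, ?_⟩ <;> linarith

/-- If the form vanishes, so do all seven linear forms, and `v` is a multiple of the infinitesimal
rotation; `(v 0).im = 0` excludes this direction. -/
theorem squareHessian_neg {γ : ℝ} (h0 : 0 < γ) (h1 : γ < 9 / 4) {v : Fin 4 → ℂ}
    (hv0 : (v 0).im = 0) (hv : v ≠ 0) : squareHessian γ v < 0 := by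
  have hs := squareHessian_eq_sum_squares (by positivity) (by positivity) v
  by_contra! hneg
  have hc : 0 < γ * (36 - 16 * γ) / ((4 * γ + 6) * (γ + 4)) := by
    have : 0 < 36 - 16 * γ := by linarith
    positivity
  set A := (v 0).re + (v 1).im - (v 2).re - (v 3).im with hA
  set B := (v 0).re - (v 1).im - (v 2).re + (v 3).im with hB
  set C := (v 0).im + (v 1).re - (v 2).im - (v 3).re with hC
  set F := (v 0).re + (v 1).re + (v 2).re + (v 3).re with hF
  set G := (v 0).im + (v 1).im + (v 2).im + (v 3).im with hG
  set H := (v 0).re - (v 1).re + (v 2).re - (v 3).re with hH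
  set J := (v 0).im - (v 1).im + (v 2).im - (v 3).im with hJ
  have p1 : 0 ≤ 2 * (4 * γ + 6) * A ^ 2 := by positivity
  have p2 : 0 ≤ (8 * γ + 4) * B ^ 2 := by positivity
  have p3 : 0 ≤ 8 * C ^ 2 := by positivity
  have p4 : 0 ≤ (4 * γ + 6) * (H + 4 * γ / (4 * γ + 6) * F) ^ 2 := by positivity
  have p5 : 0 ≤ (4 * γ + 6) * (J - 4 * γ / (4 * γ + 6) * G) ^ 2 := by positivity
  have p6 : 0 ≤ γ * (36 - 16 * γ) / ((4 * γ + 6) * (γ + 4)) * (F ^ 2 + G ^ 2) := by positivity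
  obtain ⟨q1, q2, q3, q4, q5, q6⟩ := eq_zero_of_sum_six_nonpos p1 p2 p3 p4 p5 p6
    (hs.symm.le.trans (by linarith only [hneg]))
  have hz : ∀ {c x : ℝ}, 0 < c → c * x ^ 2 = 0 → x = 0 := fun hc h =>
    pow_eq_zero_iff two_ne_zero |>.1 ((mul_eq_zero.1 h).resolve_left hc.ne')
  have z1 : A = 0 := hz (by positivity) q1
  have z2 : B = 0 := hz (by positivity) q2
  have z3 : C = 0 := hz (by positivity) q3
  have z6 : F ^ 2 + G ^ 2 = 0 := (mul_eq_zero.1 q6).resolve_left hc.ne'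
  have zF : F = 0 :=
    pow_eq_zero_iff two_ne_zero |>.1 (by linarith only [z6, sq_nonneg F, sq_nonneg G])
  have zG : G = 0 :=
    pow_eq_zero_iff two_ne_zero |>.1 (by linarith only [z6, sq_nonneg F, sq_nonneg G])
  have z4 : H = 0 := by
    have := hz (by positivity) q4
    rwa [zF, mul_zero, add_zero] at this
  have z5 : J = 0 := by
    have := hz (by positivity) q5
    rwa [zG, mul_zero, sub_zero] at this
  apply hv
  funext i
  fin_cases i <;> apply Complex.ext <;>
    simp only [Fin.zero_eta, Fin.mk_one, Fin.reduceFinMk, Pi.zero_apply, Complex.zero_re,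
      Complex.zero_im] <;>
    linarith only [hA, hB, hC, hF, hG, hH, hJ, z1, z2, z3, zF, zG, z4, z5, hv0]

theorem squareHessian_smul (γ t : ℝ) (v : Fin 4 → ℂ) :
    squareHessian γ (t • v) = t ^ 2 * squareHessian γ v := by
  have h : ∀ w a : ℂ, ((((t : ℂ) * w) / a) ^ 2).re = t ^ 2 * ((w / a) ^ 2).re := by
    intro w a
    rw [mul_div_assoc, mul_pow, ← Complex.ofReal_pow, Complex.re_ofReal_mul]
  simp only [squareHessian, squareImpulse, Pi.smul_apply, Complex.real_smul, ← mul_sub, h,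
    ← Finset.mul_sum, Complex.normSq_mul, Complex.normSq_ofReal]
  ring

theorem continuous_squareHessian (γ : ℝ) : Continuous (squareHessian γ) := by
  unfold squareHessian squareImpulse
  have h : Continuous Complex.normSq := Complex.continuous_normSq
  fun_prop

/-- Compactness of the unit sphere of the slice and homogeneity of degree two. -/
theorem exists_squareHessian_le {γ : ℝ} (h0 : 0 < γ) (h1 : γ < 9 / 4) :
    ∃ κ > 0, ∀ v : Fin 4 → ℂ, (v 0).im = 0 → squareHessian γ v ≤ -κ * ‖v‖ ^ 2 := by
  set S : Set (Fin 4 → ℂ) := Metric.sphere 0 1 ∩ {v | (v 0).im = 0} with hS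
  have hcl : IsClosed {v : Fin 4 → ℂ | (v 0).im = 0} :=
    isClosed_eq (Complex.continuous_im.comp (continuous_apply 0)) continuous_const
  have hSc : IsCompact S := (isCompact_sphere 0 1).inter_right hcl
  have hSn : S.Nonempty := by
    refine ⟨fun _ => 1, ?_, by simp⟩
    rw [mem_sphere_zero_iff_norm, pi_norm_const, norm_one]
  obtain ⟨w, hw, hmax⟩ := hSc.exists_isMaxOn hSn (continuous_squareHessian γ).continuousOn
  have hw0 : w ≠ 0 := by
    rintro rfl
    simpa using hw.1
  refine ⟨-squareHessian γ w, neg_pos.2 (squareHessian_neg h0 h1 hw.2 hw0), fun v hv => ?_⟩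
  rcases eq_or_ne v 0 with rfl | hv0
  · simpa using (squareHessian_smul γ 0 0).le
  have hn : ‖v‖ ≠ 0 := norm_ne_zero_iff.2 hv0
  have hu : ‖v‖⁻¹ • v ∈ S := by
    constructor
    · rw [mem_sphere_zero_iff_norm, norm_smul, norm_inv, norm_norm, inv_mul_cancel₀ hn]
    · simp [hv]
  have h2 : squareHessian γ (‖v‖⁻¹ • v) ≤ squareHessian γ w := hmax hu
  have h3 : v = ‖v‖ • (‖v‖⁻¹ • v) := by rw [smul_smul, mul_inv_cancel₀ hn, one_smul]
  rw [h3, squareHessian_smul, ← h3, neg_neg, mul_comm]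
  gcongr

/-- For `0 < γ < 9 / 4` the square is, modulo rotations, an isolated point of the set where the
energy and the impulse take the values that they have at the square. -/
theorem eventually_eq_squareVertices {γ : ℝ} (h0 : 0 < γ) (h1 : γ < 9 / 4) :
    ∀ᶠ z in 𝓝 squareVertices, (z 0).im = 0 → squareImpulse γ z = 4 →
      squareEnergy γ z = squareEnergy γ squareVertices → z = squareVertices := by
  obtain ⟨κ, hκ, hq⟩ := exists_squareHessian_le h0 h1
  let R : (Fin 4 → ℂ) → ℝ := fun v =>
    γ * ∑ i, logRemainder (v i / squareVertices i) +
      ∑ i, ∑ j ∈ Finset.Ioi i,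
        logRemainder ((v i - v j) / (squareVertices i - squareVertices j))
  have hR : R =o[𝓝 0] fun v => ‖v‖ ^ 2 := by
    refine (Asymptotics.IsLittleO.const_mul_left
        (Asymptotics.IsLittleO.fun_sum fun i _ => ?_) _).add
      (Asymptotics.IsLittleO.fun_sum fun i _ => Asymptotics.IsLittleO.fun_sum fun j _ => ?_)
    · exact logRemainder_comp_isLittleO
        (ContinuousLinearMap.proj (R := ℝ) (φ := fun _ : Fin 4 => ℂ) i) _
    · exact logRemainder_comp_isLittleO
        (ContinuousLinearMap.proj (R := ℝ) (φ := fun _ : Fin 4 => ℂ) i -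
          ContinuousLinearMap.proj (R := ℝ) (φ := fun _ : Fin 4 => ℂ) j) _
  have hne : ∀ᶠ z in 𝓝 squareVertices, (∀ i, z i ≠ 0) ∧ ∀ i j, i < j → z i - z j ≠ 0 := by
    refine (eventually_all.2 fun i => ?_).and
      (eventually_all.2 fun i => eventually_all.2 fun j => ?_)
    · exact (continuous_apply i).continuousAt.eventually_ne (squareVertices_ne_zero i)
    · by_cases hij : i < j
      · filter_upwards [((continuous_apply i).sub (continuous_apply j)).continuousAt.eventually_ne
          (squareVertices_sub_ne_zero hij)] with z hz _ using hz
      · exact Eventually.of_forall fun z h => absurd h hij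
  have ht : Tendsto (fun z => z - squareVertices) (𝓝 squareVertices) (𝓝 0) := by
    have : Continuous fun z : Fin 4 → ℂ => z - squareVertices := by fun_prop
    simpa using this.tendsto squareVertices
  filter_upwards [hne, ht.eventually (hR.bound (half_pos hκ))] with z hz hRz hz0 hI hE
  set v := z - squareVertices with hv
  have hzv : z = squareVertices + v := by rw [hv]; abel
  have hv0 : (v 0).im = 0 := by
    rw [hv, Pi.sub_apply, Complex.sub_im, hz0]
    simp [squareVertices]
  have e1 : ∀ i, Real.log (Complex.normSq (z i)) =
      Real.log (Complex.normSq (squareVertices i)) + (2 * (v i / squareVertices i).re -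
        ((v i / squareVertices i) ^ 2).re) + logRemainder (v i / squareVertices i) := fun i => by
    have h := hz.1 i
    have e : z i = squareVertices i + v i := by rw [hzv, Pi.add_apply]
    rw [e] at h ⊢
    exact log_normSq_add (squareVertices_ne_zero i) h
  have e2 : ∀ i, ∀ j ∈ Finset.Ioi i, Real.log (Complex.normSq (z i - z j)) =
      Real.log (Complex.normSq (squareVertices i - squareVertices j)) +
      (2 * ((v i - v j) / (squareVertices i - squareVertices j)).re -
        (((v i - v j) / (squareVertices i - squareVertices j)) ^ 2).re) +
      logRemainder ((v i - v j) / (squareVertices i - squareVertices j)) := fun i j hij => by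
    have h := hz.2 i j (Finset.mem_Ioi.1 hij)
    have e : z i - z j = squareVertices i - squareVertices j + (v i - v j) := by
      rw [hv, Pi.sub_apply, Pi.sub_apply]; ring
    rw [e] at h ⊢
    exact log_normSq_add (squareVertices_sub_ne_zero (Finset.mem_Ioi.1 hij)) h
  -- On the impulse level no linear term is left. With equal energies this gives `0 = squareHessian
  -- γ v + R v ≤ -κ ‖v‖² + (κ / 2) ‖v‖²`, so `v = 0`.
  have hsum : squareEnergy γ z = squareEnergy γ squareVertices + squareHessian γ v + R v := by
    have h := squareHessian_eq (γ := γ) (by positivity) v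
    rw [← hzv, hI, sub_self, mul_zero, add_zero] at h
    rw [squareEnergy, squareEnergy, ← h]
    simp only [e1]
    rw [Finset.sum_congr rfl fun i _ => Finset.sum_congr rfl (e2 i)]
    simp only [Finset.sum_add_distrib, R]
    ring
  have hle := hq v hv0
  rw [Real.norm_eq_abs, Real.norm_eq_abs, abs_of_nonneg (by positivity : (0:ℝ) ≤ ‖v‖ ^ 2)] at hRz
  have hRv := (le_abs_self _).trans hRz
  have : ‖v‖ ^ 2 ≤ 0 := by nlinarith
  have hvz : v = 0 := by
    rw [← norm_eq_zero]
    nlinarith [norm_nonneg v]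
  rw [hzv, hvz, add_zero]

/-! ### Hermitian matrices with a positive definite weight -/

section Weighted

variable {n : Type*} [Fintype n]

open scoped ComplexOrder in
theorem re_trace_conjTranspose_mul_self_nonneg (R : Matrix n n ℂ) : 0 ≤ (Rᴴ * R).trace.re :=
  (Complex.nonneg_iff.1 (posSemidef_conjTranspose_mul_self R).trace_nonneg).1

open scoped ComplexOrder in
theorem eq_zero_of_re_trace_conjTranspose_mul_self {R : Matrix n n ℂ}
    (h : (Rᴴ * R).trace.re = 0) : R = 0 :=
  trace_conjTranspose_mul_self_eq_zero_iff.1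
    (Complex.ext h (Complex.nonneg_iff.1 (posSemidef_conjTranspose_mul_self R).trace_nonneg).2.symm)

/-- With `N = S²`, the trace is the squared Frobenius norm of `S A S`; this gives positivity
although `A * N` need not be Hermitian. -/
theorem trace_weighted_sq {A N S : Matrix n n ℂ} (hA : Aᴴ = A) (hS : Sᴴ = S) (hN : S * S = N) :
    (A * N * (A * N)).trace = ((S * A * S)ᴴ * (S * A * S)).trace := by
  have h1 : (S * A * S)ᴴ * (S * A * S) = S * (A * N * A * S) := by
    simp only [conjTranspose_mul, hA, hS, ← hN, Matrix.mul_assoc]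
  rw [h1, trace_mul_comm S, Matrix.mul_assoc _ S S, hN, ← Matrix.mul_assoc (A * N)]

theorem re_trace_weighted_sq_nonneg {A N S : Matrix n n ℂ} (hA : Aᴴ = A) (hS : Sᴴ = S)
    (hN : S * S = N) : 0 ≤ (A * N * (A * N)).trace.re := by
  rw [trace_weighted_sq hA hS hN]
  exact re_trace_conjTranspose_mul_self_nonneg _

theorem eq_zero_of_re_trace_weighted_sq [DecidableEq n] {A N S : Matrix n n ℂ}
    (hA : Aᴴ = A) (hS : Sᴴ = S)
    (hN : S * S = N) (hu : IsUnit S) (h : (A * N * (A * N)).trace.re = 0) : A = 0 := by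
  rw [trace_weighted_sq hA hS hN] at h
  have h0 := eq_zero_of_re_trace_conjTranspose_mul_self h
  rwa [hu.mul_left_eq_zero, hu.mul_right_eq_zero] at h0

/-- A Hermitian `m` with `m N m = l m` and `tr (m N) = l`, for a positive definite `N`, has rank
one. -/
theorem apply_eq_col_mul_row_div [DecidableEq n] {m N S : Matrix n n ℂ} {l : ℝ} (hm : mᴴ = m)
    (hS : Sᴴ = S) (hN : S * S = N) (hu : IsUnit S) (hl : m * N * m = (l : ℂ) • m)
    (htr : (m * N).trace.re = l) {k : n} (hk : m k k ≠ 0) (i j : n) :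
    m i j = m i k * m k j / m k k := by
  set E : Matrix n n ℂ := single k k 1 with hE
  have hEE : E * m * E = m k k • E := by
    rw [hE, single_mul_mul_single, smul_single]
    simp
  have hEH : Eᴴ = E := by rw [hE, conjTranspose_single, star_one]
  have hEm : (E * m).trace = m k k := by rw [hE, trace_single_mul, one_smul]
  have hkk : star (m k k) = m k k := by
    have := congrFun (congrFun hm k) k
    rwa [conjTranspose_apply] at this
  set c : ℂ := (m k k)⁻¹ with hc
  -- `r` is the rank-one matrix with the same column and row `k` as `m`; the goal is `m = r`.
  set r := c • (m * E * m) with hr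
  have hrH : rᴴ = r := by
    rw [hr, conjTranspose_smul, conjTranspose_mul, conjTranspose_mul, hm, hEH, hc, star_inv₀, hkk,
      Matrix.mul_assoc]
  have hmNr : m * N * r = (l : ℂ) • r := by
    rw [hr, mul_smul_comm, ← Matrix.mul_assoc, ← Matrix.mul_assoc, hl, smul_mul_assoc,
      smul_mul_assoc, smul_comm]
  have hrNm : r * N * m = (l : ℂ) • r := by
    rw [hr, smul_mul_assoc, smul_mul_assoc, Matrix.mul_assoc (m * E),
      Matrix.mul_assoc (m * E), hl, mul_smul_comm,
      smul_comm]
  have hrNr : r * N * r = (l : ℂ) • r := by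
    have : r * N * r = c • (r * N * m * (E * m)) := by
      rw [hr, mul_smul_comm, ← hr]
      simp only [Matrix.mul_assoc]
    rw [this, hrNm, smul_mul_assoc, smul_comm]
    congr 1
    rw [hr, smul_mul_assoc, ← Matrix.mul_assoc, Matrix.mul_assoc m E m,
      Matrix.mul_assoc m (E * m) E, hEE,
      mul_smul_comm, smul_mul_assoc, smul_smul c (m k k), hc, inv_mul_cancel₀ hk,
      one_smul, Matrix.mul_assoc]
  have htr' : (r * N).trace = l := by
    have : (m * E * m * N).trace = (E * (m * N * m)).trace := by
      rw [Matrix.mul_assoc, Matrix.mul_assoc, trace_mul_comm, Matrix.mul_assoc]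
    rw [hr, smul_mul_assoc, trace_smul, this, hl, mul_smul_comm, trace_smul, hEm, hc, smul_eq_mul,
      smul_eq_mul]
    field_simp
  -- The difference satisfies the same quadratic equation but has weighted trace `l - l = 0`, so its
  -- weighted norm vanishes.
  have hF : (m - r) * N * ((m - r) * N) = (l : ℂ) • ((m - r) * N) := by
    rw [← Matrix.mul_assoc]
    have : (m - r) * N * (m - r) = (l : ℂ) • (m - r) := by
      rw [sub_mul, sub_mul, mul_sub, mul_sub, hl, hmNr, hrNm, hrNr, smul_sub]
      abel
    rw [this, smul_mul_assoc]
  have h0 : m - r = 0 := by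
    refine eq_zero_of_re_trace_weighted_sq (by rw [conjTranspose_sub, hm, hrH]) hS hN hu ?_
    rw [hF, trace_smul, smul_eq_mul, Complex.re_ofReal_mul, sub_mul, trace_sub, Complex.sub_re,
      htr, htr', Complex.ofReal_re, sub_self, mul_zero]
  have hij := congrFun (congrFun (sub_eq_zero.1 h0) i) j
  rw [hij, hr, Matrix.smul_apply, hE, Matrix.mul_assoc, mul_apply, Finset.sum_eq_single k]
  · rw [single_mul_apply_same, one_mul, hc, smul_eq_mul]
    field_simp
  · intro b _ hb
    rw [single_mul_apply_of_ne _ _ _ _ _ hb, mul_zero]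
  · simp

end Weighted

/-! ### Five vortices -/

theorem totalCirculation_square (γ : ℝ) : totalCirculation (squareCirculation γ) = γ + 4 := by
  simp [totalCirculation, squareCirculation, Fin.sum_univ_five]
  ring

theorem squareCirculation_castSucc (γ : ℝ) (i : Fin 4) : squareCirculation γ i.castSucc = 1 := by
  fin_cases i <;> rfl

theorem squareCirculation_last (γ : ℝ) : squareCirculation γ (Fin.last 4) = γ := rfl

/-- The `4 × 4` matrix all of whose entries are `1`. -/
def onesMatrix (R : Type*) [One R] : Matrix (Fin 4) (Fin 4) R := Matrix.of fun _ _ => 1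

theorem onesMatrix_mul_self (R : Type*) [CommRing R] :
    onesMatrix R * onesMatrix R = (4 : R) • onesMatrix R := by
  ext i j
  simp [onesMatrix, mul_apply]

theorem kMatrix_square {γ : ℝ} (hγ : γ + 4 ≠ 0) :
    kMatrix (squareCirculation γ) = (1 / (γ + 4)) • onesMatrix ℝ - 1 := by
  ext i j
  simp only [kMatrix, totalCirculation_square, squareCirculation_castSucc, Matrix.smul_apply,
    Matrix.sub_apply, Matrix.of_apply, onesMatrix, Matrix.one_apply, smul_eq_mul]
  split_ifs
  · field_simp
    ring
  · ring

theorem kMatrix_square_mul {γ : ℝ} (h0 : γ ≠ 0) (hγ : γ + 4 ≠ 0) :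
    kMatrix (squareCirculation γ) * -(1 + (1 / γ) • onesMatrix ℝ) = 1 := by
  rw [kMatrix_square hγ]
  simp only [sub_mul, mul_neg, mul_add, mul_one, one_mul, smul_mul_smul_comm,
    onesMatrix_mul_self, smul_smul]
  have : (1 / (γ + 4)) • onesMatrix ℝ + (1 / (γ + 4) * (1 / γ) * 4) • onesMatrix ℝ =
      (1 / γ) • onesMatrix ℝ := by
    rw [← add_smul]
    congr 1
    field_simp
  rw [← this]
  abel

theorem isUnit_det_kMatrix_square {γ : ℝ} (h0 : γ ≠ 0) (hγ : γ + 4 ≠ 0) :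
    IsUnit (kMatrix (squareCirculation γ)).det :=
  isUnit_det_of_right_inverse (kMatrix_square_mul h0 hγ)

theorem kInv_square {γ : ℝ} (h0 : γ ≠ 0) (hγ : γ + 4 ≠ 0) :
    kInv (squareCirculation γ) = -(1 + (1 / γ : ℂ) • onesMatrix ℂ) := by
  rw [kInv, inv_eq_right_inv (kMatrix_square_mul h0 hγ)]
  ext i j
  simp [onesMatrix, one_apply]
  split_ifs <;> simp

theorem exists_sq_eq_neg_kMatrixC {γ : ℝ} (h0 : 0 < γ) :
    ∃ S : Matrix (Fin 4) (Fin 4) ℂ, Sᴴ = S ∧ S * S = -kMatrixC (squareCirculation γ) ∧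
      IsUnit S := by
  have hγ : γ + 4 ≠ 0 := by positivity
  -- `N` is the identity minus `1 / (γ + 4)` times the all-ones matrix, with eigenvalues `1` and `γ
  -- / (γ + 4)`, the latter on constant vectors. There `S` acts as `1 - 4 s`, the square root of the
  -- latter.
  set s : ℝ := (1 - √(γ / (γ + 4))) / 4 with hs
  have hsq : 2 * s - 4 * s ^ 2 = 1 / (γ + 4) := by
    have h := Real.sq_sqrt (show 0 ≤ γ / (γ + 4) by positivity)
    have h2 : γ / (γ + 4) = 1 - 4 * (1 / (γ + 4)) := by
      field_simp
      ring
    rw [hs]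
    linear_combination (-1 / 4) * h - 1 / 4 * h2
  set S : Matrix (Fin 4) (Fin 4) ℂ := 1 - (s : ℂ) • onesMatrix ℂ with hS
  have hSS : S * S = -kMatrixC (squareCirculation γ) := by
    have hK : -kMatrixC (squareCirculation γ) = 1 - ((1 / (γ + 4) : ℝ) : ℂ) • onesMatrix ℂ := by
      rw [kMatrixC, kMatrix_square hγ]
      ext i j
      simp [onesMatrix, one_apply]
      split_ifs <;> simp
    rw [hK, ← hsq, hS]
    simp only [sub_mul, mul_sub, mul_one, one_mul, smul_mul_smul_comm, onesMatrix_mul_self,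
      smul_smul]
    push_cast
    module
  refine ⟨S, ?_, hSS, ?_⟩
  · ext i j
    simp [hS, onesMatrix, conjTranspose_apply, one_apply, eq_comm]
  · refine IsUnit.of_mul_eq_one (S * -kInv (squareCirculation γ)) ?_
    rw [← Matrix.mul_assoc, hSS, neg_mul_neg,
      kMatrixC_mul_kInv (isUnit_det_kMatrix_square h0.ne' hγ)]

theorem toMatrix_momentumMap_apply {n : ℕ} (z : Fin n → ℂ) (i j : Fin n) :
    toMatrix (momentumMap z) i j = Complex.I * (z i * star (z j)) := by
  rw [toMatrix_momentumMap, Matrix.smul_apply, vecMulVec_apply, Pi.star_apply, smul_eq_mul]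

theorem entry_momentumMap {n : ℕ} (z : Fin n → ℂ) (i j : Fin n) :
    entry (momentumMap z) i j = z i * star (z j) := by
  rw [entry, toMatrix_momentumMap_apply, ← mul_assoc, neg_mul, Complex.I_mul_I, neg_neg, one_mul]

theorem sqDistRef_momentumMap {n : ℕ} (z : Fin n → ℂ) (i : Fin n) :
    sqDistRef (momentumMap z) i = Complex.normSq (z i) := by
  rw [sqDistRef, entry_momentumMap, Complex.star_def, Complex.mul_conj, Complex.ofReal_re]

theorem sqDist_momentumMap {n : ℕ} (z : Fin n → ℂ) (i j : Fin n) :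
    sqDist (momentumMap z) i j = Complex.normSq (z i - z j) := by
  rw [sqDist, sqDistRef_momentumMap, sqDistRef_momentumMap, entry_momentumMap]
  simp [Complex.normSq_apply]
  ring

theorem squareFixedPoint_eq : squareFixedPoint = momentumMap squareVertices := by
  rw [squareFixedPoint]
  congr 1
  funext i
  fin_cases i <;> simp [relPosition, squareConfiguration, squareVertices, Fin.last]

theorem squareFixedPoint_mem : squareFixedPoint ∈ collisionFree 4 := by
  rw [squareFixedPoint_eq]
  refine ⟨fun i => ?_, fun i j hij => ?_⟩
  · rw [sqDistRef_momentumMap]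
    exact Complex.normSq_pos.2 (squareVertices_ne_zero i)
  · rw [sqDist_momentumMap]
    exact Complex.normSq_pos.2 (squareVertices_sub_ne_zero hij)

theorem hamiltonian_momentumMap_square (γ : ℝ) (z : Fin 4 → ℂ) :
    hamiltonian (squareCirculation γ) (momentumMap z) =
      -(1 / (4 * Real.pi)) * squareEnergy γ z := by
  simp only [hamiltonian, squareEnergy, sqDistRef_momentumMap, sqDist_momentumMap,
    squareCirculation_castSucc, squareCirculation_last, one_mul]

/-- The Hermitian matrix `[μ_{ij}]`. -/
def hermitianMatrix {n : ℕ} (μ : ShapeSpace n) : Matrix (Fin n) (Fin n) ℂ :=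
  (-Complex.I) • toMatrix μ

theorem hermitianMatrix_apply {n : ℕ} (μ : ShapeSpace n) (i j : Fin n) :
    hermitianMatrix μ i j = entry μ i j := rfl

theorem conjTranspose_hermitianMatrix {n : ℕ} (μ : ShapeSpace n) :
    (hermitianMatrix μ)ᴴ = hermitianMatrix μ := by
  rw [hermitianMatrix, conjTranspose_smul, conjTranspose_toMatrix]
  simp

theorem eq_momentumMap_iff {n : ℕ} {μ : ShapeSpace n} {z : Fin n → ℂ} :
    μ = momentumMap z ↔ ∀ i j, entry μ i j = z i * star (z j) := by
  refine ⟨fun h i j => by rw [h, entry_momentumMap], fun h => toMatrix_injective ?_⟩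
  ext i j
  rw [toMatrix_momentumMap_apply, ← h, entry, ← mul_assoc, mul_neg, Complex.I_mul_I, neg_neg,
    one_mul]

theorem continuous_entry {n : ℕ} (i j : Fin n) :
    Continuous fun μ : ShapeSpace n => entry μ i j := by
  have h : Continuous (toMatrix (n := n)) := LinearMap.continuous_of_finiteDimensional _
  exact continuous_const.mul ((continuous_apply j).comp ((continuous_apply i).comp h))

theorem laxMatrix_eq {n : ℕ} (Γ : Fin (n + 1) → ℝ) (μ : ShapeSpace n) :
    laxMatrix Γ μ = -(hermitianMatrix μ * -kMatrixC Γ) := by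
  rw [laxMatrix, hermitianMatrix, mul_neg, neg_neg]

theorem trace_vecMulVec_mul_kMatrixC {γ : ℝ} (hγ : γ + 4 ≠ 0) (z : Fin 4 → ℂ) :
    (vecMulVec z (star z) * -kMatrixC (squareCirculation γ)).trace.re = squareImpulse γ z := by
  rw [vecMulVec_mul, trace_vecMulVec, dotProduct_comm, ← dotProduct_mulVec]
  rw [kMatrixC, kMatrix_square hγ]
  simp [squareImpulse, dotProduct, mulVec, Fin.sum_univ_four, onesMatrix, Complex.normSq_apply,
    one_apply]
  field_simp
  ring

/-! ### The Lyapunov function and its strict minimum -/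

/-- The Casimir function that vanishes on the matrices of rank at most one with the angular
impulse of the square. -/
def rankCasimir (γ : ℝ) (μ : ShapeSpace 4) : ℝ :=
  reTrace 4 ((laxMatrix (squareCirculation γ) μ * laxMatrix (squareCirculation γ) μ +
      (4 : ℝ) • laxMatrix (squareCirculation γ) μ) *
    (laxMatrix (squareCirculation γ) μ * laxMatrix (squareCirculation γ) μ +
      (4 : ℝ) • laxMatrix (squareCirculation γ) μ))

/-- The conserved function that proves the stability of the square. -/
def squareLyapunov (γ : ℝ) (μ : ShapeSpace 4) : ℝ :=
  (hamiltonian (squareCirculation γ) μ - hamiltonian (squareCirculation γ) squareFixedPoint) ^ 2 +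
    rankCasimir γ μ + (reTrace 4 (laxMatrix (squareCirculation γ) μ) + 4) ^ 2

theorem rankCasimir_eq (γ : ℝ) (μ : ShapeSpace 4) :
    let m := hermitianMatrix μ
    let N := -kMatrixC (squareCirculation γ)
    rankCasimir γ μ = ((m * N * m - ((4 : ℝ) : ℂ) • m) * N *
      ((m * N * m - ((4 : ℝ) : ℂ) • m) * N)).trace.re := by
  intro m N
  have h : laxMatrix (squareCirculation γ) μ * laxMatrix (squareCirculation γ) μ +
      (4 : ℝ) • laxMatrix (squareCirculation γ) μ = (m * N * m - ((4 : ℝ) : ℂ) • m) * N := by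
    rw [laxMatrix_eq, neg_mul_neg, sub_mul, smul_mul_assoc, smul_neg, ← sub_eq_add_neg,
      ← Matrix.mul_assoc]
    rfl
  rw [rankCasimir, h, reTrace_apply]

theorem squareLyapunov_nonneg_and_eq {γ : ℝ} (h0 : 0 < γ) (μ : ShapeSpace 4) :
    0 ≤ squareLyapunov γ μ ∧ (squareLyapunov γ μ = 0 →
      hamiltonian (squareCirculation γ) μ = hamiltonian (squareCirculation γ) squareFixedPoint ∧
      (hermitianMatrix μ * -kMatrixC (squareCirculation γ)).trace.re = 4 ∧
      (entry μ 0 0 ≠ 0 → ∀ i j, entry μ i j = entry μ i 0 * entry μ 0 j / entry μ 0 0)) := by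
  obtain ⟨S, hS, hN, hu⟩ := exists_sq_eq_neg_kMatrixC h0
  set m := hermitianMatrix μ with hm
  set N := -kMatrixC (squareCirculation γ) with hNd
  have hmH : mᴴ = m := conjTranspose_hermitianMatrix μ
  have hNH : Nᴴ = N := by rw [← hN, conjTranspose_mul, hS]
  have hWH : (m * N * m - ((4 : ℝ) : ℂ) • m)ᴴ = m * N * m - ((4 : ℝ) : ℂ) • m := by
    rw [conjTranspose_sub, conjTranspose_smul, conjTranspose_mul, conjTranspose_mul, hmH, hNH,
      ← Matrix.mul_assoc, Complex.star_def, Complex.conj_ofReal]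
  have hC : 0 ≤ rankCasimir γ μ := by
    rw [rankCasimir_eq]
    exact re_trace_weighted_sq_nonneg hWH hS hN
  refine ⟨by unfold squareLyapunov; positivity, fun hV => ?_⟩
  unfold squareLyapunov at hV
  have hs1 := sq_nonneg (hamiltonian (squareCirculation γ) μ -
    hamiltonian (squareCirculation γ) squareFixedPoint)
  have hs2 := sq_nonneg (reTrace 4 (laxMatrix (squareCirculation γ) μ) + 4)
  have hC0 : rankCasimir γ μ = 0 := by linarith
  have htr : (m * N).trace.re = 4 := by
    have h2 : reTrace 4 (laxMatrix (squareCirculation γ) μ) + 4 = 0 :=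
      pow_eq_zero_iff two_ne_zero |>.1 (by linarith)
    rw [reTrace_apply, laxMatrix_eq, trace_neg, Complex.neg_re] at h2
    linarith
  refine ⟨sub_eq_zero.1 (pow_eq_zero_iff two_ne_zero |>.1 (by linarith)), htr, fun hk i j => ?_⟩
  rw [rankCasimir_eq] at hC0
  have hW := eq_zero_of_re_trace_weighted_sq hWH hS hN hu hC0
  exact apply_eq_col_mul_row_div hmH hS hN hu (sub_eq_zero.1 hW) htr hk i j

theorem eventually_squareLyapunov_pos {γ : ℝ} (h0 : 0 < γ) (h1 : γ < 9 / 4) :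
    ∀ᶠ μ in 𝓝 squareFixedPoint, μ ≠ squareFixedPoint → 0 < squareLyapunov γ μ := by
  -- For `[μ_ij] = z z*` the first column is `z` times the conjugate of `z 0`. Dividing by `|z 0|`
  -- recovers `z` with its phase chosen so that `z 0 > 0`.
  let z : ShapeSpace 4 → Fin 4 → ℂ := fun μ i => entry μ i 0 / (√(entry μ 0 0).re : ℝ)
  have hz0 : z squareFixedPoint = squareVertices := by
    funext i
    simp only [z, squareFixedPoint_eq, entry_momentumMap]
    simp [squareVertices]
  have hre : Continuous fun μ : ShapeSpace 4 => (entry μ 0 0).re :=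
    Complex.continuous_re.comp (continuous_entry 0 0)
  have hre0 : (0 : ℝ) < (entry squareFixedPoint 0 0).re := by
    rw [squareFixedPoint_eq, entry_momentumMap]
    simp [squareVertices]
  have hzc : Tendsto z (𝓝 squareFixedPoint) (𝓝 squareVertices) := by
    rw [← hz0]
    refine tendsto_pi_nhds.2 fun i => ?_
    refine ((continuous_entry i 0).continuousAt).div
      (Complex.continuous_ofReal.comp hre.sqrt).continuousAt ?_
    exact Complex.ofReal_ne_zero.2 (Real.sqrt_ne_zero'.2 hre0)
  filter_upwards [hzc.eventually (eventually_eq_squareVertices h0 h1),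
    hre.continuousAt.eventually (lt_mem_nhds hre0)] with μ hμ hpos hne
  obtain ⟨hnn, heq⟩ := squareLyapunov_nonneg_and_eq h0 μ
  refine lt_of_le_of_ne hnn fun hV => hne ?_
  obtain ⟨hE, htr, hrank⟩ := heq hV.symm
  have hH : ∀ i j, star (entry μ i j) = entry μ j i := fun i j =>
    congrFun (congrFun (conjTranspose_hermitianMatrix μ) j) i
  have h00 : entry μ 0 0 = ((entry μ 0 0).re : ℂ) := (Complex.conj_eq_iff_re.1 (hH 0 0)).symm
  have h00' : entry μ 0 0 ≠ 0 := fun h => by rw [h] at hpos; exact lt_irrefl _ hpos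
  have hsq : ((√(entry μ 0 0).re : ℝ) : ℂ) * (√(entry μ 0 0).re : ℝ) = entry μ 0 0 := by
    rw [← Complex.ofReal_mul, Real.mul_self_sqrt hpos.le, ← h00]
  have hμz : μ = momentumMap (z μ) := by
    rw [eq_momentumMap_iff]
    intro i j
    rw [hrank h00' i j]
    simp only [z, star_div₀, hH]
    rw [Complex.star_def, Complex.conj_ofReal, div_mul_div_comm, hsq]
  have him : (z μ 0).im = 0 := by
    simp only [z]
    rw [h00, ← Complex.ofReal_div, Complex.ofReal_im]
  have hI : squareImpulse γ (z μ) = 4 := by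
    rw [← trace_vecMulVec_mul_kMatrixC (by positivity), ← htr]
    congr 3
    ext i j
    rw [hermitianMatrix_apply, eq_momentumMap_iff.1 hμz i j, vecMulVec_apply, Pi.star_apply]
  have hE' : squareEnergy γ (z μ) = squareEnergy γ squareVertices := by
    rw [hμz, squareFixedPoint_eq, hamiltonian_momentumMap_square, hamiltonian_momentumMap_square]
      at hE
    exact mul_left_cancel₀ (neg_ne_zero.2 (by positivity)) hE
  rw [hμz, hμ him hI hE', squareFixedPoint_eq]

theorem squareLyapunov_fixedPoint {γ : ℝ} (hγ : γ + 4 ≠ 0) :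
    squareLyapunov γ squareFixedPoint = 0 := by
  have hm : hermitianMatrix squareFixedPoint = vecMulVec squareVertices (star squareVertices) := by
    ext i j
    rw [hermitianMatrix_apply, squareFixedPoint_eq, entry_momentumMap, vecMulVec_apply,
      Pi.star_apply]
  -- The vertices sum to zero, so the all-ones part of `N` annihilates them and `m N m = (z* z) m =
  -- 4 m`.
  have hN : -kMatrixC (squareCirculation γ) *ᵥ squareVertices = squareVertices := by
    rw [kMatrixC, kMatrix_square hγ]
    funext i
    simp [mulVec, dotProduct, Fin.sum_univ_four, onesMatrix, one_apply, squareVertices]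
    fin_cases i <;> simp <;> ring
  have hzz : star squareVertices ⬝ᵥ squareVertices = 4 := by
    simp [dotProduct, Fin.sum_univ_four, squareVertices]
    norm_num
  have hW : hermitianMatrix squareFixedPoint * -kMatrixC (squareCirculation γ) *
      hermitianMatrix squareFixedPoint - ((4 : ℝ) : ℂ) • hermitianMatrix squareFixedPoint = 0 := by
    rw [hm, Matrix.mul_assoc, mul_vecMulVec, hN, vecMulVec_mul_vecMulVec, hzz, vecMulVec_smul]
    simp
  have htr : reTrace 4 (laxMatrix (squareCirculation γ) squareFixedPoint) = -4 := by
    rw [reTrace_apply, laxMatrix_eq, trace_neg, Complex.neg_re, hm, trace_mul_comm,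
      mul_vecMulVec, hN, trace_vecMulVec, dotProduct_comm, hzz]
    simp
  have hC := rankCasimir_eq γ squareFixedPoint
  simp only [hW] at hC
  rw [squareLyapunov, hC, htr]
  simp

section MatrixNorm

attribute [local instance] Matrix.linftyOpNormedRing Matrix.linftyOpNormedAlgebra

theorem differentiableAt_squareLyapunov {γ : ℝ} {μ : ShapeSpace 4} (hμ : μ ∈ collisionFree 4) :
    DifferentiableAt ℝ (squareLyapunov γ) μ := by
  have hP : DifferentiableAt ℝ (laxMatrix (squareCirculation γ)) μ :=
    (contDiff_laxMatrix _).differentiable one_ne_zero μ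
  have hh : DifferentiableAt ℝ (hamiltonian (squareCirculation γ)) μ :=
    (hasGradientAt_hamiltonian _ hμ).differentiableAt
  have hW := (hP.mul hP).add (hP.const_smul (4 : ℝ))
  exact (((hh.sub_const _).pow 2).add ((reTrace 4).differentiableAt.comp μ (hW.mul hW))).add
    ((((reTrace 4).differentiableAt.comp μ hP).add_const 4).pow 2)

/-- The Lyapunov function is conserved. -/
theorem exists_hasFDerivAt_squareLyapunov {γ : ℝ} (h0 : γ ≠ 0) (hγ : γ + 4 ≠ 0) {μ : ShapeSpace 4}
    (hμ : μ ∈ collisionFree 4) : ∃ V' : ShapeSpace 4 →L[ℝ] ℝ,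
      HasFDerivAt (squareLyapunov γ) V' μ ∧
        V' (relativeVectorField (squareCirculation γ) μ) = 0 := by
  have hV := (differentiableAt_squareLyapunov (γ := γ) hμ).hasFDerivAt
  refine ⟨_, hV, ?_⟩
  set v := relativeVectorField (squareCirculation γ) μ with hv
  -- Only the derivative at `0` matters, so a straight line with velocity `X_h(μ)` replaces the
  -- integral curve.
  let x : ℝ → ShapeSpace 4 := fun s => μ + s • v
  have hx0 : x 0 = μ := by simp [x]
  have hx : HasDerivAt x (liePoisson (squareCirculation γ)
      (hamiltonian (squareCirculation γ)) (x 0))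
      0 := by
    rw [hx0]
    simpa [x] using! ((hasDerivAt_id (0 : ℝ)).smul_const v).const_add μ
  have hP := hasDerivAt_laxMatrix (isUnit_det_kMatrix_square h0 hγ) hx
  have hW := hasDerivAt_add_smul_of_lax 4 (hasDerivAt_mul_of_lax hP hP) hP
  have hC := hasDerivAt_reTrace_of_lax (hasDerivAt_mul_of_lax hW hW)
  have hT := hasDerivAt_reTrace_of_lax hP
  have hg := hasGradientAt_hamiltonian (squareCirculation γ) hμ
  have hh : HasDerivAt (fun s => hamiltonian (squareCirculation γ) (x s)) 0 0 := by
    have h1 := hg.hasFDerivAt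
    rw [← hx0] at h1
    refine (h1.comp_hasDerivAt 0 hx).congr_deriv ?_
    rw [InnerProductSpace.toDual_apply_apply, hx0, ← functionalDerivative_hamiltonian _ hμ,
      inner_functionalDerivative_liePoisson]
  have hVx := (((hh.sub_const
    (hamiltonian (squareCirculation γ) squareFixedPoint)).pow 2).add hC).add
      ((hT.add_const 4).pow 2)
  have hVx' : HasDerivAt (squareLyapunov γ ∘ x) 0 0 := by
    refine hVx.congr_deriv ?_
    simp
  rw [← hx0] at hV
  have := (hV.comp_hasDerivAt 0 hx).unique hVx'
  rwa [hx0] at this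

end MatrixNorm

theorem lyapunovStable_square {γ : ℝ} (h0 : 0 < γ) (h1 : γ < 9 / 4) :
    LyapunovStable (relativeVectorField (squareCirculation γ)) (collisionFree 4)
      squareFixedPoint :=
  lyapunovStable_of_conserved (V := squareLyapunov γ) (isOpen_collisionFree 4)
    squareFixedPoint_mem (contDiffOn_relativeVectorField _)
    (squareLyapunov_fixedPoint (by positivity)) (eventually_squareLyapunov_pos h0 h1)
    fun _ => exists_hasFDerivAt_squareLyapunov h0.ne' (by positivity)

/-! ### The linearization of the relative dynamics -/

/-- The derivative of the gradient of the Hamiltonian at `μ` in the direction `ν`. -/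
def hamiltonianGradientDeriv {n : ℕ} (Γ : Fin (n + 1) → ℝ) (μ ν : ShapeSpace n) : ShapeSpace n :=
  -(1 / (4 * Real.pi)) •
    (Γ (Fin.last n) • ∑ i : Fin n,
        (-(Γ i.castSucc * sqDistRef ν i) / sqDistRef μ i ^ 2) • sqDistRefVec i +
      ∑ i : Fin n, ∑ j ∈ Finset.Ioi i,
        (-(Γ i.castSucc * Γ j.castSucc * sqDist ν i j) / sqDist μ i j ^ 2) • sqDistVec i j)

theorem sqDistRef_add_smul {n : ℕ} (μ ν : ShapeSpace n) (s : ℝ) (i : Fin n) :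
    sqDistRef (μ + s • ν) i = sqDistRef μ i + s * sqDistRef ν i := by
  simp only [← inner_sqDistRefVec, inner_add_right, real_inner_smul_right]

theorem sqDist_add_smul {n : ℕ} (μ ν : ShapeSpace n) (s : ℝ) (i j : Fin n) :
    sqDist (μ + s • ν) i j = sqDist μ i j + s * sqDist ν i j := by
  simp only [← inner_sqDistVec, inner_add_right, real_inner_smul_right]

theorem hasDerivAt_const_div_add_mul {a : ℝ} (c b : ℝ) (ha : a ≠ 0) :
    HasDerivAt (fun s : ℝ => c / (a + s * b)) (-(c * b) / a ^ 2) 0 := by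
  have h : HasDerivAt (fun s : ℝ => a + s * b) b 0 := by
    simpa using! ((hasDerivAt_id (0 : ℝ)).mul_const b).const_add a
  have h2 := (hasDerivAt_const (0 : ℝ) c).div h (by simpa using ha)
  simpa using! h2

theorem hasDerivAt_hamiltonianGradient {n : ℕ} (Γ : Fin (n + 1) → ℝ) {μ : ShapeSpace n}
    (hμ : μ ∈ collisionFree n) (ν : ShapeSpace n) :
    HasDerivAt (fun s : ℝ => hamiltonianGradient Γ (μ + s • ν))
      (hamiltonianGradientDeriv Γ μ ν) 0 := by
  simp only [hamiltonianGradient, sqDistRef_add_smul, sqDist_add_smul]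
  have h1 : ∀ i : Fin n, HasDerivAt
      (fun s : ℝ => (Γ i.castSucc / (sqDistRef μ i + s * sqDistRef ν i)) • sqDistRefVec i)
      ((-(Γ i.castSucc * sqDistRef ν i) / sqDistRef μ i ^ 2) • sqDistRefVec i) 0 := fun i =>
    (hasDerivAt_const_div_add_mul _ _ (hμ.1 i).ne').smul_const _
  have h2 : ∀ i, ∀ j ∈ Finset.Ioi i, HasDerivAt (fun s : ℝ =>
      (Γ i.castSucc * Γ j.castSucc / (sqDist μ i j + s * sqDist ν i j)) • sqDistVec i j)
      ((-(Γ i.castSucc * Γ j.castSucc * sqDist ν i j) / sqDist μ i j ^ 2) • sqDistVec i j) 0 :=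
    fun i j hj => (hasDerivAt_const_div_add_mul _ _
      (hμ.2 i j (Finset.mem_Ioi.1 hj)).ne').smul_const _
  exact (((HasDerivAt.fun_sum fun i (_ : i ∈ Finset.univ) => h1 i).const_smul
    (Γ (Fin.last n))).add (HasDerivAt.fun_sum fun i (_ : i ∈ Finset.univ) =>
      HasDerivAt.fun_sum (h2 i))).const_smul (-(1 / (4 * Real.pi)))

theorem toMatrix_relativeVectorField {n : ℕ} (Γ : Fin (n + 1) → ℝ) {μ : ShapeSpace n}
    (hμ : μ ∈ collisionFree n) :
    toMatrix (relativeVectorField Γ μ) =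
      kInv Γ * toMatrix (hamiltonianGradient Γ μ) * toMatrix μ -
        (kInv Γ * toMatrix (hamiltonianGradient Γ μ) * toMatrix μ)ᴴ := by
  rw [relativeVectorField, liePoisson, toMatrix_ofMatrix, functionalDerivative_hamiltonian Γ hμ]
  simp only [conjTranspose_mul, conjTranspose_toMatrix, kInv_conjTranspose, neg_mul, mul_neg,
    neg_neg, Matrix.mul_assoc]
  abel

section MatrixNorm

attribute [local instance] Matrix.linftyOpNormedRing Matrix.linftyOpNormedAlgebra

theorem toMatrix_fderiv_relativeVectorField {n : ℕ} {Γ : Fin (n + 1) → ℝ} {μ : ShapeSpace n}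
    (hμ : μ ∈ collisionFree n) {A : ShapeSpace n →L[ℝ] ShapeSpace n}
    (hA : HasFDerivAt (relativeVectorField Γ) A μ) (ν : ShapeSpace n) :
    let Q := kInv Γ * toMatrix (hamiltonianGradient Γ μ) * toMatrix ν +
      kInv Γ * toMatrix (hamiltonianGradientDeriv Γ μ ν) * toMatrix μ
    toMatrix (A ν) = Q - Qᴴ := by
  intro Q
  let x : ℝ → ShapeSpace n := fun s => μ + s • ν
  have hx0 : x 0 = μ := by simp [x]
  have hx : HasDerivAt x ν 0 := by
    simpa [x] using! ((hasDerivAt_id (0 : ℝ)).smul_const ν).const_add μ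
  have hm : HasDerivAt (fun s => toMatrix (x s)) (toMatrix ν) 0 :=
    (toMatrixL n).hasFDerivAt.comp_hasDerivAt 0 hx
  have hD : HasDerivAt (fun s => toMatrix (hamiltonianGradient Γ (x s)))
      (toMatrix (hamiltonianGradientDeriv Γ μ ν)) 0 :=
    (toMatrixL n).hasFDerivAt.comp_hasDerivAt 0 (hasDerivAt_hamiltonianGradient Γ hμ ν)
  have hX : HasDerivAt (fun s => toMatrix (relativeVectorField Γ (x s))) (toMatrix (A ν)) 0 := by
    rw [← hx0] at hA
    exact (toMatrixL n).hasFDerivAt.comp_hasDerivAt 0 (hA.comp_hasDerivAt 0 hx)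
  have hF := (((hm.mul hD).mul_const (kInv Γ)).neg).add ((hD.const_mul (kInv Γ)).mul hm)
  have hmem : ∀ᶠ s in 𝓝 (0 : ℝ), x s ∈ collisionFree n :=
    hx.continuousAt.eventually ((isOpen_collisionFree n).mem_nhds (hx0 ▸ hμ))
  have heq := hX.unique (hF.congr_of_eventuallyEq (hmem.mono fun s hs => by
    simp only [relativeVectorField, liePoisson, toMatrix_ofMatrix,
      functionalDerivative_hamiltonian Γ hs]
    rfl))
  rw [heq]
  simp only [Q, hx0, conjTranspose_add, conjTranspose_mul, conjTranspose_toMatrix,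
    kInv_conjTranspose, neg_mul, mul_neg, neg_neg, Matrix.mul_assoc, add_mul]
  abel

end MatrixNorm

/-- Both unstable eigenvalues found below are real, so a real eigenvector suffices. -/
theorem hasEigenvalue_baseChange {E : Type*} [AddCommGroup E] [Module ℝ E] {A : E →ₗ[ℝ] E}
    {v : E} (hv : v ≠ 0) {l : ℝ} (h : A v = l • v) :
    Module.End.HasEigenvalue (A.baseChange ℂ) (l : ℂ) := by
  refine Module.End.hasEigenvalue_of_hasEigenvector (x := (1 : ℂ) ⊗ₜ[ℝ] v)
    ⟨Module.End.mem_eigenspace_iff.2 ?_, ?_⟩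
  · rw [LinearMap.baseChange_tmul, h, TensorProduct.tmul_smul, TensorProduct.smul_tmul',
      TensorProduct.smul_tmul']
    simp
  · rwa [Ne, Module.FaithfullyFlat.one_tmul_eq_zero_iff]

/-- The derivative of `momentumMap` at `z` in the direction `w`. -/
def tangentVec {n : ℕ} (z w : Fin n → ℂ) : ShapeSpace n :=
  momentumMap (z + w) - momentumMap z - momentumMap w

/-- Polarization of the quadratic map `momentumMap`; in this form the vector lies in `𝔳`
automatically, and the squared distances can be evaluated on it by linearity. -/
theorem toMatrix_tangentVec {n : ℕ} (z w : Fin n → ℂ) :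
    toMatrix (tangentVec z w) = Complex.I • (vecMulVec w (star z) + vecMulVec z (star w)) := by
  simp only [tangentVec, map_sub, toMatrix_momentumMap, star_add, add_vecMulVec, vecMulVec_add]
  module

theorem sqDistRef_tangentVec {n : ℕ} (z w : Fin n → ℂ) (i : Fin n) :
    sqDistRef (tangentVec z w) i = 2 * (w i * star (z i)).re := by
  rw [← inner_sqDistRefVec, tangentVec, inner_sub_right, inner_sub_right, inner_sqDistRefVec,
    inner_sqDistRefVec, inner_sqDistRefVec, sqDistRef_momentumMap, sqDistRef_momentumMap,
    sqDistRef_momentumMap]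
  simp [Complex.normSq_apply]
  ring

theorem sqDist_tangentVec {n : ℕ} (z w : Fin n → ℂ) (i j : Fin n) :
    sqDist (tangentVec z w) i j = 2 * ((w i - w j) * star (z i - z j)).re := by
  rw [← inner_sqDistVec, tangentVec, inner_sub_right, inner_sub_right, inner_sqDistVec,
    inner_sqDistVec, inner_sqDistVec, sqDist_momentumMap, sqDist_momentumMap, sqDist_momentumMap]
  simp [Complex.normSq_apply]
  ring

theorem sqDistRefVec_mulVec {n : ℕ} (i : Fin n) (z : Fin n → ℂ) :
    toMatrix (sqDistRefVec i) *ᵥ z = (2 * Complex.I * z i) • Pi.single i 1 := by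
  rw [sqDistRefVec, map_smul, toMatrix_momentumMap, smul_mulVec, smul_mulVec, vecMulVec_mulVec]
  funext k
  simp [Pi.star_single]
  ring

theorem sqDistVec_mulVec {n : ℕ} (i j : Fin n) (z : Fin n → ℂ) :
    toMatrix (sqDistVec i j) *ᵥ z =
      (2 * Complex.I * (z i - z j)) • (Pi.single i 1 - Pi.single j 1) := by
  rw [sqDistVec, map_smul, toMatrix_momentumMap, smul_mulVec, smul_mulVec, vecMulVec_mulVec]
  funext k
  simp [Pi.star_single, sub_dotProduct]
  ring

/-- If `w` solves the linear equation of the variations at `z`, then `tangentVec z w` is an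
eigenvector of the linearization. -/
theorem fderiv_relativeVectorField_tangentVec {n : ℕ} {Γ : Fin (n + 1) → ℝ} {z w : Fin n → ℂ}
    (hz : momentumMap z ∈ collisionFree n) {A : ShapeSpace n →L[ℝ] ShapeSpace n}
    (hA : HasFDerivAt (relativeVectorField Γ) A (momentumMap z)) {g l : ℝ}
    (hDz : kInv Γ *ᵥ toMatrix (hamiltonianGradient Γ (momentumMap z)) *ᵥ z =
      (-(Complex.I * g)) • z)
    (hw : kInv Γ *ᵥ (toMatrix (hamiltonianGradient Γ (momentumMap z)) *ᵥ w +
      toMatrix (hamiltonianGradientDeriv Γ (momentumMap z) (tangentVec z w)) *ᵥ z) =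
      (l - Complex.I * g : ℂ) • w) :
    A (tangentVec z w) = l • tangentVec z w := by
  apply toMatrix_injective
  rw [toMatrix_fderiv_relativeVectorField hz hA (tangentVec z w)]
  -- The part with factor `g`, due to the rotation, is Hermitian and drops out of `Q - Qᴴ`; the part
  -- with `l` gives `l • tangentVec z w`.
  have hQ : kInv Γ * toMatrix (hamiltonianGradient Γ (momentumMap z)) * toMatrix (tangentVec z w) +
      kInv Γ * toMatrix (hamiltonianGradientDeriv Γ (momentumMap z) (tangentVec z w)) *
        toMatrix (momentumMap z) =
      (Complex.I * l) • vecMulVec w (star z) +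
        (g : ℂ) • (vecMulVec w (star z) + vecMulVec z (star w)) := by
    have e : ∀ u v : Fin n → ℂ, ∀ D : Matrix (Fin n) (Fin n) ℂ,
        kInv Γ * D * vecMulVec u v = vecMulVec (kInv Γ *ᵥ D *ᵥ u) v := by
      intro u v D
      rw [mul_vecMulVec, mulVec_mulVec]
    rw [mulVec_add] at hw
    rw [toMatrix_tangentVec, toMatrix_momentumMap, mul_smul_comm, mul_smul_comm, mul_add, e, e, e,
      hDz, ← smul_add, add_right_comm, ← add_vecMulVec, hw, smul_vecMulVec, smul_vecMulVec]
    have hI : Complex.I * Complex.I = -1 := Complex.I_mul_I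
    ext i j
    simp only [Matrix.smul_apply, Matrix.add_apply, smul_eq_mul]
    linear_combination (-(g : ℂ) * (vecMulVec w (star z) i j + vecMulVec z (star w) i j)) * hI
  rw [hQ, map_smul, toMatrix_tangentVec]
  simp only [conjTranspose_add, conjTranspose_smul,
    conjTranspose_vecMulVec, star_star, Complex.star_def, map_mul, Complex.conj_ofReal,
    Complex.conj_I]
  ext i j
  simp only [Matrix.smul_apply, Matrix.add_apply, Matrix.sub_apply, smul_eq_mul, Complex.real_smul]
  ring

/-- The hypothesis says that `z` rotates uniformly; then `𝒦⁻¹ (δh/δμ) μ = g z z*` is Hermitian, and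
the field is its anti-Hermitian part up to a factor. -/
theorem relativeVectorField_momentumMap_eq_zero {n : ℕ} {Γ : Fin (n + 1) → ℝ} {z : Fin n → ℂ}
    (hz : momentumMap z ∈ collisionFree n) {g : ℝ}
    (hDz : kInv Γ *ᵥ toMatrix (hamiltonianGradient Γ (momentumMap z)) *ᵥ z =
      (-(Complex.I * g)) • z) : relativeVectorField Γ (momentumMap z) = 0 := by
  apply toMatrix_injective
  have hQ : kInv Γ * toMatrix (hamiltonianGradient Γ (momentumMap z)) * toMatrix (momentumMap z) =
      (g : ℂ) • vecMulVec z (star z) := by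
    rw [toMatrix_momentumMap, mul_smul_comm, mul_vecMulVec, ← mulVec_mulVec, hDz, smul_vecMulVec,
      smul_smul]
    congr 1
    linear_combination -(g : ℂ) * Complex.I_mul_I
  rw [toMatrix_relativeVectorField Γ hz, hQ, conjTranspose_smul, conjTranspose_vecMulVec, star_star,
    Complex.star_def, Complex.conj_ofReal, sub_self, map_zero]

/-! ### The linearization at the square with centre -/

theorem kInv_square_mulVec {γ : ℝ} (h0 : γ ≠ 0) (hγ : γ + 4 ≠ 0) (u : Fin 4 → ℂ) (i : Fin 4) :
    (kInv (squareCirculation γ) *ᵥ u) i = -(u i + 1 / γ * (u 0 + u 1 + u 2 + u 3)) := by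
  rw [kInv_square h0 hγ, neg_mulVec, add_mulVec, one_mulVec, smul_mulVec]
  simp [onesMatrix, mulVec, dotProduct, Fin.sum_univ_four]

/-- The gradient and its directional derivative are both of this form, with different coefficients
`a` and `b`. -/
theorem toMatrix_gradientSum_mulVec (γ : ℝ) (a : Fin 4 → ℝ) (b : Fin 4 → Fin 4 → ℝ)
    (u : Fin 4 → ℂ) :
    toMatrix (-(1 / (4 * Real.pi)) • (γ • ∑ i, a i • sqDistRefVec i +
      ∑ i, ∑ j ∈ Finset.Ioi i, b i j • sqDistVec i j)) *ᵥ u =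
    (-(Complex.I / (2 * Real.pi))) • ![
      γ * a 0 * u 0 + b 0 1 * (u 0 - u 1) + b 0 2 * (u 0 - u 2) + b 0 3 * (u 0 - u 3),
      γ * a 1 * u 1 + b 0 1 * (u 1 - u 0) + b 1 2 * (u 1 - u 2) + b 1 3 * (u 1 - u 3),
      γ * a 2 * u 2 + b 0 2 * (u 2 - u 0) + b 1 2 * (u 2 - u 1) + b 2 3 * (u 2 - u 3),
      γ * a 3 * u 3 + b 0 3 * (u 3 - u 0) + b 1 3 * (u 3 - u 1) + b 2 3 * (u 3 - u 2)] := by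
  obtain ⟨h0, h1, h2, h3⟩ := Ioi_fin_four
  simp only [map_smul, map_add, map_sum, smul_mulVec, add_mulVec, sum_mulVec, sqDistRefVec_mulVec,
    sqDistVec_mulVec, Fin.sum_univ_four, h0, h1, h2, h3]
  have hpi : (Real.pi : ℂ) ≠ 0 := Complex.ofReal_ne_zero.2 Real.pi_ne_zero
  funext k
  fin_cases k <;> simp <;> field_simp <;> ring

theorem sqDistRef_squareVertices (i : Fin 4) : sqDistRef (momentumMap squareVertices) i = 1 := by
  rw [sqDistRef_momentumMap]
  fin_cases i <;> simp [squareVertices]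

theorem sqDist_squareVertices :
    sqDist (momentumMap squareVertices) 0 1 = 2 ∧ sqDist (momentumMap squareVertices) 0 2 = 4 ∧
    sqDist (momentumMap squareVertices) 0 3 = 2 ∧ sqDist (momentumMap squareVertices) 1 2 = 2 ∧
    sqDist (momentumMap squareVertices) 1 3 = 4 ∧ sqDist (momentumMap squareVertices) 2 3 = 2 := by
  simp only [sqDist_momentumMap, squareVertices, Complex.normSq_apply]
  refine ⟨?_, ?_, ?_, ?_, ?_, ?_⟩ <;> simp <;> norm_num

theorem hamiltonianGradient_square_mulVec (γ : ℝ) (u : Fin 4 → ℂ) :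
    toMatrix (hamiltonianGradient (squareCirculation γ) (momentumMap squareVertices)) *ᵥ u =
    (-(Complex.I / (2 * Real.pi))) • ![
      γ * u 0 + (u 0 - u 1) / 2 + (u 0 - u 2) / 4 + (u 0 - u 3) / 2,
      γ * u 1 + (u 1 - u 0) / 2 + (u 1 - u 2) / 2 + (u 1 - u 3) / 4,
      γ * u 2 + (u 2 - u 0) / 4 + (u 2 - u 1) / 2 + (u 2 - u 3) / 2,
      γ * u 3 + (u 3 - u 0) / 2 + (u 3 - u 1) / 4 + (u 3 - u 2) / 2] := by
  obtain ⟨h01, h02, h03, h12, h13, h23⟩ := sqDist_squareVertices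
  rw [hamiltonianGradient, squareCirculation_last, toMatrix_gradientSum_mulVec]
  simp only [squareCirculation_castSucc, sqDistRef_squareVertices, h01, h02, h03, h12, h13, h23]
  congr 1
  funext k
  fin_cases k <;> simp <;> ring

theorem hamiltonianGradientDeriv_square_mulVec (γ : ℝ) (w : Fin 4 → ℂ) :
    toMatrix (hamiltonianGradientDeriv (squareCirculation γ) (momentumMap squareVertices)
      (tangentVec squareVertices w)) *ᵥ squareVertices =
    (Complex.I / Real.pi) • ![
      γ * (w 0).re + ((w 0 - w 1).re - (w 0 - w 1).im) / 4 * (1 - Complex.I) +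
        (w 0 - w 2).re / 4 + ((w 0 - w 3).re + (w 0 - w 3).im) / 4 * (1 + Complex.I),
      γ * (w 1).im * Complex.I + ((w 0 - w 1).re - (w 0 - w 1).im) / 4 * (Complex.I - 1) +
        ((w 1 - w 2).re + (w 1 - w 2).im) / 4 * (1 + Complex.I) +
        (w 1 - w 3).im / 4 * Complex.I,
      γ * (w 2).re - (w 0 - w 2).re / 4 -
        ((w 1 - w 2).re + (w 1 - w 2).im) / 4 * (1 + Complex.I) -
        ((w 2 - w 3).re - (w 2 - w 3).im) / 4 * (Complex.I - 1),
      γ * (w 3).im * Complex.I -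
        ((w 0 - w 3).re + (w 0 - w 3).im) / 4 * (1 + Complex.I) -
        (w 1 - w 3).im / 4 * Complex.I +
        ((w 2 - w 3).re - (w 2 - w 3).im) / 4 * (Complex.I - 1)] := by
  obtain ⟨h01, h02, h03, h12, h13, h23⟩ := sqDist_squareVertices
  rw [hamiltonianGradientDeriv, squareCirculation_last, toMatrix_gradientSum_mulVec]
  simp only [squareCirculation_castSucc, sqDistRef_squareVertices, h01, h02, h03, h12, h13, h23,
    sqDistRef_tangentVec, sqDist_tangentVec]
  have hpi : (Real.pi : ℂ) ≠ 0 := Complex.ofReal_ne_zero.2 Real.pi_ne_zero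
  funext k
  fin_cases k <;> simp [squareVertices] <;> field_simp <;> ring

theorem kInv_mulVec_hamiltonianGradient_square {γ : ℝ} (h0 : γ ≠ 0) (hγ : γ + 4 ≠ 0) :
    kInv (squareCirculation γ) *ᵥ
      toMatrix (hamiltonianGradient (squareCirculation γ) (momentumMap squareVertices)) *ᵥ
        squareVertices =
      (-(Complex.I * (-(γ + 3 / 2) / (2 * Real.pi) : ℝ))) • squareVertices := by
  have hpi : (Real.pi : ℂ) ≠ 0 := Complex.ofReal_ne_zero.2 Real.pi_ne_zero
  have h0' : (γ : ℂ) ≠ 0 := Complex.ofReal_ne_zero.2 h0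
  funext k
  rw [kInv_square_mulVec h0 hγ, hamiltonianGradient_square_mulVec]
  fin_cases k <;> simp [squareVertices] <;> field_simp <;> ring

/-! ### Explicit unstable eigenvectors -/

/-- Eigenvectors of the linearization give linear instability. -/
theorem linearlyUnstable_square {γ l : ℝ} (h0 : γ ≠ 0) (hγ : γ + 4 ≠ 0) (hl : 0 < l)
    {w : Fin 4 → ℂ} (hw0 : (w 0).re ≠ 0)
    (hw : kInv (squareCirculation γ) *ᵥ
      (toMatrix (hamiltonianGradient (squareCirculation γ) (momentumMap squareVertices)) *ᵥ w +
        toMatrix (hamiltonianGradientDeriv (squareCirculation γ) (momentumMap squareVertices)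
          (tangentVec squareVertices w)) *ᵥ squareVertices) =
      (l - Complex.I * (-(γ + 3 / 2) / (2 * Real.pi) : ℝ) : ℂ) • w) :
    LinearlyUnstable (relativeVectorField (squareCirculation γ)) squareFixedPoint := by
  have hmem := squareFixedPoint_mem
  rw [squareFixedPoint_eq] at hmem ⊢
  have hA := (((contDiffOn_relativeVectorField (squareCirculation γ)).contDiffAt
    ((isOpen_collisionFree 4).mem_nhds hmem)).differentiableAt one_ne_zero).hasFDerivAt
  refine ⟨_, hA, l, by simpa using hl, hasEigenvalue_baseChange (v := tangentVec squareVertices w)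
    (fun h => hw0 ?_) ?_⟩
  -- The eigenvector is not zero because it changes the squared distance of the first vortex from
  -- the centre by `2 (w 0).re`.
  · have h1 := sqDistRef_tangentVec squareVertices w 0
    rw [h, ← inner_sqDistRefVec, inner_zero_right] at h1
    simpa [squareVertices] using h1
  · exact fderiv_relativeVectorField_tangentVec hmem hA
      (kInv_mulVec_hamiltonianGradient_square h0 hγ) hw

/-- The mode `w k / z k = ± (1 + σ i)` with alternating signs. Opposite entries cancel, so `𝒦⁻¹`
acts as `-1`, and `σ² = -(2γ + 1) / 2` is positive exactly for `γ < -1/2`. -/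
theorem linearlyUnstable_square_of_lt {γ : ℝ} (h0 : γ ≠ 0) (hγ : γ + 4 ≠ 0) (h : γ < -1 / 2) :
    LinearlyUnstable (relativeVectorField (squareCirculation γ)) squareFixedPoint := by
  set σ : ℝ := √(-(2 * γ + 1) / 2) with hσ
  have hσ0 : 0 < σ := Real.sqrt_pos.2 (by linarith)
  have hsq : σ ^ 2 = -(2 * γ + 1) / 2 := Real.sq_sqrt (by linarith)
  have hsqC : (σ : ℂ) ^ 2 = -(2 * γ + 1) / 2 := by exact_mod_cast congrArg Complex.ofReal hsq
  have hpi : (Real.pi : ℂ) ≠ 0 := Complex.ofReal_ne_zero.2 Real.pi_ne_zero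
  have h0' : (γ : ℂ) ≠ 0 := Complex.ofReal_ne_zero.2 h0
  have hI : Complex.I ^ 2 = -1 := Complex.I_sq
  refine linearlyUnstable_square (l := σ / Real.pi) h0 hγ (by positivity)
    (w := ![1 + σ * Complex.I, σ - Complex.I, -(1 + σ * Complex.I), -(σ - Complex.I)])
    (by simp) ?_
  funext k
  rw [kInv_square_mulVec h0 hγ, hamiltonianGradient_square_mulVec,
    hamiltonianGradientDeriv_square_mulVec]
  fin_cases k <;> simp <;> field_simp <;> grind

/-- Here opposite vertices move in parallel: `w 0 = w 2` and `w 1 = w 3`. This is the block with the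
coefficient `36 - 16 * γ`, which equals `-4 ρ²`. -/
theorem linearlyUnstable_square_of_gt {γ : ℝ} (h : 9 / 4 < γ) :
    LinearlyUnstable (relativeVectorField (squareCirculation γ)) squareFixedPoint := by
  have h0 : γ ≠ 0 := by linarith
  have hγ : γ + 4 ≠ 0 := by linarith
  set ρ : ℝ := √(4 * γ - 9) with hρ
  have hρ0 : 0 < ρ := Real.sqrt_pos.2 (by linarith)
  have hsq : ρ ^ 2 = 4 * γ - 9 := Real.sq_sqrt (by linarith)
  have hsqC : (ρ : ℂ) ^ 2 = 4 * γ - 9 := by exact_mod_cast congrArg Complex.ofReal hsq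
  have hpi : (Real.pi : ℂ) ≠ 0 := Complex.ofReal_ne_zero.2 Real.pi_ne_zero
  have h0' : (γ : ℂ) ≠ 0 := Complex.ofReal_ne_zero.2 h0
  have hI : Complex.I ^ 2 = -1 := Complex.I_sq
  refine linearlyUnstable_square (l := ρ / (4 * Real.pi)) h0 hγ (by positivity)
    (w := ![-3 - ρ * Complex.I, -(4 * γ + 3) - ρ * Complex.I, -3 - ρ * Complex.I,
      -(4 * γ + 3) - ρ * Complex.I])
    (by simp) ?_
  funext k
  rw [kInv_square_mulVec h0 hγ, hamiltonianGradient_square_mulVec,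
    hamiltonianGradientDeriv_square_mulVec]
  fin_cases k <;> simp <;> field_simp <;> grind

end VortexRelative

end

theorem mainTheorem2 (γ : ℝ) (hγ : γ ≠ 0)
    (hΓ : VortexRelative.totalCirculation (VortexRelative.squareCirculation γ) ≠ 0) :
    VortexRelative.relativeVectorField (VortexRelative.squareCirculation γ)
        VortexRelative.squareFixedPoint = 0 ∧
    (0 < γ → γ < 9 / 4 →
      VortexRelative.LyapunovStable
        (VortexRelative.relativeVectorField (VortexRelative.squareCirculation γ))
        (VortexRelative.collisionFree 4) VortexRelative.squareFixedPoint) ∧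
    (γ < -1 / 2 ∨ 9 / 4 < γ →
      VortexRelative.LinearlyUnstable
        (VortexRelative.relativeVectorField (VortexRelative.squareCirculation γ))
        VortexRelative.squareFixedPoint) := by
  rw [VortexRelative.totalCirculation_square] at hΓ
  refine ⟨?_, VortexRelative.lyapunovStable_square, fun h => h.elim
    (VortexRelative.linearlyUnstable_square_of_lt hγ hΓ)
    VortexRelative.linearlyUnstable_square_of_gt⟩
  have hmem := VortexRelative.squareFixedPoint_mem
  rw [VortexRelative.squareFixedPoint_eq] at hmem ⊢
  exact VortexRelative.relativeVectorField_momentumMap_eq_zero hmem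
    (VortexRelative.kInv_mulVec_hamiltonianGradient_square hγ hΓ)
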